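/- **Conventions.** For $n\ge 1$ let $\mathsf{scpx}_{\neq\emptyset}(n)$ be the set of non-empty families $K$ of subsets of $[n]=\{1,\dots,n\}$ such that $J\subseteq I\in K$ implies $J\in K$; the symmetric group acts on the right by $K\cdot\sigma=\{\sigma^{-1}(I)\mid I\in K\}$. For $K\in\mathsf{scpx}_{\neq\emptyset}(n)$, $L\in\mathsf{scpx}_{\neq\emptyset}(m)$ and $k\in[n]$, the substitution $K\circ_k L\in \mathsf{scpx}_{\neq\emptyset}(n+m-1)$ is the set of all $I\circ_k J$ with $I\in K$, $J\in L$, where $$I\circ_k J=\begin{cases} I^{<k}\sqcup (J+k-1)\sqcup (I^{>k}+m-1) & k\in I,\\ I^{<k}\sqcup (I^{>k}+m-1) & k\notin I,\end{cases}$$ with $I^{<k}=\{i\in I\mid i<k\}$, $I^{>k}=\{i\in I\mid i>k\}$. With the unit $\pm=\{\emptyset,\{1\}\}\in\mathsf{scpx}_{\neq\emptyset}(1)$ this is a symmetric operad in sets (with no operation of arity $0$), the non-empty substitution operad $(\mathsf{scpx}_{\neq\emptyset},\{\circ_k\})$. Let $(\mathrm C,\otimes,e)$ be a symmetric monoidal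 category with finite colimits, whose tensor product preserves finite colimits in each variable; for instance any small cocomplete symmetric monoidal category whose tensor product preserves colimits in each variable. For a sequence $\underline f=(f_i\colon Y_i\to X_i)_{i\in[n]}$ of arrows of $\mathrm C$, the cubical functor sends $I\subseteq[n]$ to $z_n(I;\underline f)=\bigotimes_{i=1}^n Z^I_i$, with $Z_i^I=X_i$ if $i\in I$ and $Z_i^I=Y_i$ if $i\notin I$, and sends $I\subseteq J$ to the tensor product of the $f_i$, $i\in J\setminus I$, and of identities. For $K\in\mathsf{scpx}_{\neq\emptyset}(n)$ let $\operatorname{cat}(K)$ be the poset of faces of $K$ and let $$\overrightarrow{\mathcal Z}_n(K;\underline f)\colon\ \bigotimes_{i=1}^n Y_i=z_n(\emptyset;\underline f)\longrightarrow \operatorname*{colim}_{I\in\operatorname{cat}(K)} z_n(I;\underline f)$$ be the canonical morphism to a (chosen) colimit, the polyhedral product map. **Theorem.** The maps $\overrightarrow{\mathcal Z}_n$ make the arrows of $\mathrm C$, considered up to isomorphism in the category of arrows, an algebra over $(\mathsf{scpx}_{\neq\emptyset},\{\circ_k\})$. Precisely: 1. For $K\in\mathsf{scpx}_{\neq\emptyset}(n)$,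 a permutation $\sigma$ of $[n]$ and arrows $f_1,\dots,f_n$, there is an isomorphism of arrows $\overrightarrow{\mathcal Z}_n(K\cdot\sigma;f_{\sigma(1)},\dots,f_{\sigma(n)})\cong\overrightarrow{\mathcal Z}_n(K;f_1,\dots,f_n)$ which on sources is the canonical symmetry isomorphism $\bigotimes_i Y_{\sigma(i)}\cong\bigotimes_i Y_i$. 2. For every arrow $f$ there is an isomorphism of arrows $\overrightarrow{\mathcal Z}_1(\pm;f)\cong f$ which on sources is the canonical unit isomorphism. 3. For $K\in\mathsf{scpx}_{\neq\emptyset}(n)$, $L\in\mathsf{scpx}_{\neq\emptyset}(m)$, $k\in[n]$ and arrows $f_1,\dots,f_{n+m-1}$, there is an isomorphism of arrows $$\overrightarrow{\mathcal Z}_{n}\bigl(K;f_1,\dots,f_{k-1},\overrightarrow{\mathcal Z}_m(L;f_k,\dots,f_{k+m-1}),f_{k+m},\dots,f_{n+m-1}\bigr)\cong\overrightarrow{\mathcal Z}_{n+m-1}(K\circ_k L;f_1,\dots,f_{n+m-1})$$ which on sources is the canonical associativity isomorphism onto $\bigotimes_{j=1}^{n+m-1}Y_j$ (the identity if $\mathrm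 C$ is strict). 4. There is an algebra structure over the symmetric unital operad $(\mathsf{scpx}_{\neq\emptyset},\{\circ_k\})$, in the usual strict sense, on the set of isomorphism classes of arrows of $\mathrm C$, whose structure maps send $(K;[f_1],\dots,[f_n])$ to $[\overrightarrow{\mathcal Z}_n(K;f_1,\dots,f_n)]$. -/

import Mathlib

open CategoryTheory CategoryTheory.Limits MonoidalCategory

universe v u

namespace PolyProd

/-! ## Inserting `[m]` into `[n]` at the position `k`

Throughout, `[n]` is `Fin n`, and the arity `n + m - 1` is a number `p` with `p + 1 = n + m`. -/

/-- The position in `[n + m - 1]` of an element `i ≠ k` of `[n]` after `k` has been replaced by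
the block `[m]`: it is `i` if `i < k`, and `i + m - 1` if `i > k`. -/
def outerIdx {n m p : ℕ} (h : p + 1 = n + m) (k : Fin n) (i : {i : Fin n // i ≠ k}) : Fin p :=
  if hi : i.1 < k then ⟨i.1, by have := k.2; omega⟩
  else ⟨i.1 + m - 1, by
    have h1 := i.1.2
    have h2 : (i.1 : ℕ) ≠ k := fun e => i.2 (Fin.ext e)
    have h3 : ¬ (i.1 : ℕ) < k := hi
    omega⟩

/-- The position in `[n + m - 1]` of the element `j` of the block `[m]` inserted at `k`
(positions are counted from `0`). -/
def innerIdx {n m p : ℕ} (h : p + 1 = n + m) (k : Fin n) (j : Fin m) : Fin p :=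
  ⟨k + j, by have := k.2; have := j.2; omega⟩

theorem slot_bijective {n m p : ℕ} (h : p + 1 = n + m) (k : Fin n) :
    Function.Bijective (Sum.elim (outerIdx h k) (innerIdx h k)) := by
  constructor
  · rintro (⟨i, hi⟩ | j) (⟨i', hi'⟩ | j') e
    · have e1 : (i : ℕ) ≠ k := fun e => hi (Fin.ext e)
      have e2 : (i' : ℕ) ≠ k := fun e => hi' (Fin.ext e)
      simp only [Sum.elim_inl, outerIdx] at e
      congr 2
      split_ifs at e with a b b <;> simp only [Fin.ext_iff] at * <;> omega
    · have e1 : (i : ℕ) ≠ k := fun e => hi (Fin.ext e)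
      have := j'.2
      simp only [Sum.elim_inl, Sum.elim_inr, outerIdx, innerIdx] at e
      split_ifs at e with a <;> simp only [Fin.ext_iff] at * <;> omega
    · have e1 : (i' : ℕ) ≠ k := fun e => hi' (Fin.ext e)
      have := j.2
      simp only [Sum.elim_inl, Sum.elim_inr, outerIdx, innerIdx] at e
      split_ifs at e with a <;> simp only [Fin.ext_iff] at * <;> omega
    · simp only [Sum.elim_inr, innerIdx, Fin.ext_iff] at e
      congr 1
      exact Fin.ext (by omega)
  · intro x
    have hx := x.2
    have hk := k.2
    by_cases h1 : (x : ℕ) < k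
    · refine ⟨Sum.inl ⟨⟨x, by omega⟩, fun e => ?_⟩, ?_⟩
      · simp [Fin.ext_iff] at e; omega
      · simp [outerIdx, Fin.lt_def, h1]
    · by_cases h2 : (x : ℕ) < k + m
      · exact ⟨Sum.inr ⟨x - k, by omega⟩, Fin.ext (by simp [innerIdx]; omega)⟩
      · refine ⟨Sum.inl ⟨⟨x + 1 - m, by omega⟩, fun e => ?_⟩, ?_⟩
        · simp [Fin.ext_iff] at e; omega
        · have : ¬ (x : ℕ) + 1 - m < k := by omega
          simp [outerIdx, Fin.lt_def, this]
          exact Fin.ext (by simp; omega)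

/-- `[n + m - 1]` is the disjoint union of `[n] \ {k}` and of the inserted block `[m]`. -/
noncomputable def slotEquiv {n m p : ℕ} (h : p + 1 = n + m) (k : Fin n) :
    {i : Fin n // i ≠ k} ⊕ Fin m ≃ Fin p :=
  Equiv.ofBijective _ (slot_bijective h k)

/-- The permutation of `[n + m - 1]` induced by a permutation `σ` of `[n]`, which moves the block
inserted at `k` onto the block inserted at `σ k`, and a permutation `τ` inside that block. -/
noncomputable def permInsert {n m p : ℕ} (h : p + 1 = n + m) (k : Fin n)
    (σ : Equiv.Perm (Fin n)) (τ : Equiv.Perm (Fin m)) : Equiv.Perm (Fin p) :=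
  (slotEquiv h k).symm.trans
    ((Equiv.sumCongr
      (σ.subtypeEquiv (p := fun i => i ≠ k) (q := fun i => i ≠ σ k) (fun _ => by simp)) τ).trans
      (slotEquiv h (σ k)))

/-- The sequence `(x_1, …, x_{k-1}, y, x_{k+m}, …, x_{n+m-1})` of length `n`. -/
def graft {α : Type*} {n m p : ℕ} (h : p + 1 = n + m) (k : Fin n) (y : α) (x : Fin p → α) :
    Fin n → α :=
  fun i => if hi : i = k then y else x (outerIdx h k ⟨i, hi⟩)

/-! ## Operads in sets and their algebras -/

/-- Unital symmetric operads in sets, given by partial compositions. -/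
structure SetOperad where
  /-- operations of arity `n` -/
  Op : ℕ → Type u
  /-- right action of the symmetric groups -/
  perm : ∀ {n : ℕ}, Op n → Equiv.Perm (Fin n) → Op n
  /-- partial composition `A ∘_k B` -/
  comp : ∀ {n m p : ℕ}, p + 1 = n + m → Fin n → Op n → Op m → Op p
  /-- the operadic unit -/
  one : Op 1
  perm_one : ∀ {n : ℕ} (A : Op n), perm A 1 = A
  perm_mul : ∀ {n : ℕ} (A : Op n) (σ τ : Equiv.Perm (Fin n)),
    perm A (σ * τ) = perm (perm A σ) τ
  /-- equivariance of the partial compositions -/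
  comp_perm : ∀ {n m p : ℕ} (h : p + 1 = n + m) (k : Fin n) (A : Op n) (B : Op m)
    (σ : Equiv.Perm (Fin n)) (τ : Equiv.Perm (Fin m)),
    comp h k (perm A σ) (perm B τ) = perm (comp h (σ k) A B) (permInsert h k σ τ)
  /-- `(A ∘_i B) ∘_{j+m-1} C = (A ∘_j C) ∘_i B` for `i < j` -/
  parallel : ∀ {l m n p q r : ℕ} (h₁ : p + 1 = l + m) (h₂ : r + 1 = p + n)
    (h₃ : q + 1 = l + n) (h₄ : r + 1 = q + m) (i j : Fin l) (hij : i < j)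
    (A : Op l) (B : Op m) (C : Op n),
    comp h₂ (outerIdx h₁ i ⟨j, hij.ne'⟩) (comp h₁ i A B) C =
      comp h₄ (outerIdx h₃ j ⟨i, hij.ne⟩) (comp h₃ j A C) B
  /-- `A ∘_i (B ∘_j C) = (A ∘_i B) ∘_{j+i-1} C` -/
  sequential : ∀ {l m n p q r : ℕ} (h₁ : q + 1 = m + n) (h₂ : r + 1 = l + q)
    (h₃ : p + 1 = l + m) (h₄ : r + 1 = p + n) (i : Fin l) (j : Fin m)
    (A : Op l) (B : Op m) (C : Op n),
    comp h₂ i A (comp h₁ j B C) = comp h₄ (innerIdx h₃ i j) (comp h₃ i A B) C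
  one_comp : ∀ {n : ℕ} (A : Op n), comp (Nat.add_comm n 1) 0 one A = A
  comp_one : ∀ {n : ℕ} (k : Fin n) (A : Op n), comp rfl k A one = A

/-- An algebra structure on the set `X` over an operad in sets. -/
structure SetOperad.Algebra (O : SetOperad.{v}) (X : Type u) where
  /-- the structure maps `O(n) × X^n → X` -/
  act : ∀ {n : ℕ}, O.Op n → (Fin n → X) → X
  act_perm : ∀ {n : ℕ} (A : O.Op n) (σ : Equiv.Perm (Fin n)) (x : Fin n → X),
    act (O.perm A σ) (x ∘ σ) = act A x
  act_one : ∀ x : Fin 1 → X, act O.one x = x 0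
  act_comp : ∀ {n m p : ℕ} (h : p + 1 = n + m) (k : Fin n) (A : O.Op n) (B : O.Op m)
    (x : Fin p → X),
    act (O.comp h k A B) x = act A (graft h k (act B (x ∘ innerIdx h k)) x)

/-! ## The substitution operad on non-empty simplicial complexes -/

/-- Non-empty abstract simplicial complexes on the vertex set `[n]`, for `n ≥ 1`. The empty set is
a face, and elements of `[n]` need not be faces (ghost vertices are allowed). -/
@[ext]
structure SCpx (n : ℕ) where
  /-- the set of faces -/
  faces : Set (Finset (Fin n))
  down_closed : ∀ {I J : Finset (Fin n)}, I ∈ faces → J ⊆ I → J ∈ faces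
  nonempty : faces.Nonempty
  pos : 0 < n

theorem SCpx.empty_mem {n : ℕ} (K : SCpx n) : ∅ ∈ K.faces := by
  obtain ⟨I, hI⟩ := K.nonempty
  exact K.down_closed hI (Finset.empty_subset I)

/-- Substitution of a subset `J ⊆ [m]` into a subset `I ⊆ [n]` at `k`: it is
`I^{<k} ⊔ (J + k - 1) ⊔ (I^{>k} + m - 1)` if `k ∈ I`, and `I^{<k} ⊔ (I^{>k} + m - 1)` if `k ∉ I`. -/
def substFace {n m p : ℕ} (h : p + 1 = n + m) (k : Fin n)
    (I : Finset (Fin n)) (J : Finset (Fin m)) : Finset (Fin p) :=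
  (Finset.univ.filter (fun i : {i : Fin n // i ≠ k} => i.1 ∈ I)).image (outerIdx h k) ∪
    if k ∈ I then J.image (innerIdx h k) else ∅

/-- The natural number `a` is (the value of) an element of the subset `S` of `Fin n`. -/
def NatMem {n : ℕ} (S : Finset (Fin n)) (a : ℕ) : Prop := ∃ ha, (⟨a, ha⟩ : Fin n) ∈ S

section
variable {n m p : ℕ} (h : p + 1 = n + m) (k : Fin n)

theorem slot_cases (x : Fin p) : (∃ i, x = outerIdx h k i) ∨ ∃ j, x = innerIdx h k j := by
  obtain ⟨i | j, e⟩ := (slot_bijective h k).2 x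
  · exact Or.inl ⟨i, e.symm⟩
  · exact Or.inr ⟨j, e.symm⟩

theorem outerIdx_mem (I : Finset (Fin n)) (J : Finset (Fin m)) (i : {i : Fin n // i ≠ k}) :
    outerIdx h k i ∈ substFace h k I J ↔ i.1 ∈ I := by
  have hb := (slot_bijective h k).1
  have h1 : ∀ i', outerIdx h k i' = outerIdx h k i ↔ i' = i := fun i' =>
    ⟨fun e => Sum.inl_injective (@hb (Sum.inl i') (Sum.inl i) e), fun e => e ▸ rfl⟩
  have h2 : ∀ j, innerIdx h k j ≠ outerIdx h k i := fun j e =>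
    Sum.inr_ne_inl (@hb (Sum.inr j) (Sum.inl i) e)
  unfold substFace
  split_ifs <;> simp [h1, h2]

theorem innerIdx_mem (I : Finset (Fin n)) (J : Finset (Fin m)) (j : Fin m) :
    innerIdx h k j ∈ substFace h k I J ↔ k ∈ I ∧ j ∈ J := by
  have hb := (slot_bijective h k).1
  have h1 : ∀ j', innerIdx h k j' = innerIdx h k j ↔ j' = j := fun j' =>
    ⟨fun e => Sum.inr_injective (@hb (Sum.inr j') (Sum.inr j) e), fun e => e ▸ rfl⟩
  have h2 : ∀ i, outerIdx h k i ≠ innerIdx h k j := fun i e =>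
    Sum.inl_ne_inr (@hb (Sum.inl i) (Sum.inr j) e)
  unfold substFace
  split_ifs with hk <;> simp [h1, h2, hk]

theorem substFace_iff' (I : Finset (Fin n)) (J : Finset (Fin m)) (a : ℕ) :
    (∃ ha, (⟨a, ha⟩ : Fin p) ∈ substFace h k I J) ↔
      (a < k ∧ ∃ ha, (⟨a, ha⟩ : Fin n) ∈ I) ∨
      (k ≤ a ∧ a < k + m ∧ k ∈ I ∧ ∃ ha, (⟨a - k, ha⟩ : Fin m) ∈ J) ∨
      (k + m ≤ a ∧ ∃ ha, (⟨a + 1 - m, ha⟩ : Fin n) ∈ I) := by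
  by_cases ha : a < p
  swap
  · have := k.2
    constructor
    · rintro ⟨h1, -⟩; omega
    · rintro (⟨h1, -⟩ | ⟨h1, h2, -⟩ | ⟨h1, h2, -⟩) <;> omega
  obtain ⟨x, rfl⟩ : ∃ x : Fin p, (x : ℕ) = a := ⟨⟨a, ha⟩, rfl⟩
  have e0 : (∃ ha, (⟨x, ha⟩ : Fin p) ∈ substFace h k I J) ↔ x ∈ substFace h k I J := by simp
  rw [e0]
  rcases slot_cases h k x with ⟨⟨i, hi⟩, rfl⟩ | ⟨j, rfl⟩
  · rw [outerIdx_mem]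
    have e1 : (i : ℕ) ≠ k := fun e => hi (Fin.ext e)
    by_cases hik : (i : ℕ) < k
    · have a1 : ¬ (k : ℕ) ≤ i := by omega
      have a2 : ¬ (k : ℕ) + m ≤ i := by omega
      simp [outerIdx, Fin.lt_def, hik, a1, a2]
    · have a1 : ¬ (i : ℕ) + m - 1 < k := by omega
      have a2 : ¬ (i : ℕ) + m - 1 < k + m := by omega
      have a3 : (k : ℕ) + m ≤ i + m - 1 := by omega
      have a4 : (i : ℕ) + m - 1 + 1 - m = i := by omega
      simp [outerIdx, Fin.lt_def, hik, a1, a2, a3, a4]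
  · rw [innerIdx_mem]
    have := j.2
    have a3 : ¬ (k : ℕ) + m ≤ k + j := by omega
    simp [innerIdx, this]

theorem substFace_iff (I : Finset (Fin n)) (J : Finset (Fin m)) (a : ℕ) :
    NatMem (substFace h k I J) a ↔
      (a < k ∧ NatMem I a) ∨ (k ≤ a ∧ a < k + m ∧ k ∈ I ∧ NatMem J (a - k)) ∨
      (k + m ≤ a ∧ NatMem I (a + 1 - m)) :=
  substFace_iff' h k I J a

end

/-- The substitution `K ∘_k L` of simplicial complexes. -/
def SCpx.subst {n m p : ℕ} (h : p + 1 = n + m) (k : Fin n) (K : SCpx n) (L : SCpx m) :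
    SCpx p where
  faces := {S | ∃ I ∈ K.faces, ∃ J ∈ L.faces, S = substFace h k I J}
  down_closed := by
    rintro _ S ⟨I, hI, J, hJ, rfl⟩ hS
    refine ⟨I.filter (fun i => if hi : i = k then True else outerIdx h k ⟨i, hi⟩ ∈ S),
      K.down_closed hI (Finset.filter_subset _ _), J.filter (fun j => innerIdx h k j ∈ S),
      L.down_closed hJ (Finset.filter_subset _ _), ?_⟩
    ext x
    rcases slot_cases h k x with ⟨i, rfl⟩ | ⟨j, rfl⟩
    · rw [outerIdx_mem]
      have := fun hx => (outerIdx_mem h k I J i).1 (hS hx)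
      simp only [Finset.mem_filter, i.2, dite_false]
      exact ⟨fun hx => ⟨this hx, hx⟩, fun hx => hx.2⟩
    · rw [innerIdx_mem]
      have := fun hx => (innerIdx_mem h k I J j).1 (hS hx)
      simp only [Finset.mem_filter, dite_true, and_true]
      exact ⟨fun hx => ⟨(this hx).1, (this hx).2, hx⟩, fun hx => hx.2.2⟩
  nonempty := ⟨_, ∅, K.empty_mem, ∅, L.empty_mem, rfl⟩
  pos := by have := K.pos; have := L.pos; omega

/-- The right action of permutations on simplicial complexes: the faces of `K · σ` are the sets
`σ⁻¹(I)`, for `I` a face of `K`. -/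
def SCpx.perm {n : ℕ} (K : SCpx n) (σ : Equiv.Perm (Fin n)) : SCpx n where
  faces := {S | S.map σ.toEmbedding ∈ K.faces}
  down_closed := fun {_ _} hI hJ => K.down_closed hI (Finset.map_subset_map.2 hJ)
  nonempty := ⟨∅, by simpa using K.empty_mem⟩
  pos := K.pos

/-- The unit `{∅, {1}}` of the substitution operad. -/
def SCpx.one : SCpx 1 where
  faces := {∅, {0}}
  down_closed := by
    rintro I J - -
    rcases Finset.eq_empty_or_nonempty J with rfl | ⟨x, hx⟩
    · simp
    · right
      ext y
      simp [Subsingleton.elim y x, Subsingleton.elim 0 x, hx]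
  nonempty := ⟨∅, by simp⟩
  pos := Nat.one_pos

theorem finset_ext_nat {n : ℕ} {S T : Finset (Fin n)}
    (h : ∀ a : ℕ, NatMem S a ↔ NatMem T a) : S = T := by
  ext x
  simpa [NatMem] using h x

theorem mem_iff_nat {n : ℕ} (S : Finset (Fin n)) (x : Fin n) :
    x ∈ S ↔ NatMem S x := by
  simp [NatMem]

theorem substFace_parallel {l m n p q r : ℕ} (h₁ : p + 1 = l + m) (h₂ : r + 1 = p + n)
    (h₃ : q + 1 = l + n) (h₄ : r + 1 = q + m) (i j : Fin l) (hij : i < j)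
    (A : Finset (Fin l)) (B : Finset (Fin m)) (C : Finset (Fin n)) :
    substFace h₂ (outerIdx h₁ i ⟨j, hij.ne'⟩) (substFace h₁ i A B) C =
      substFace h₄ (outerIdx h₃ j ⟨i, hij.ne⟩) (substFace h₃ j A C) B := by
  have hij' : (i : ℕ) < j := hij
  have hji : ¬ (j : ℕ) < i := by omega
  have v1 : ((outerIdx h₁ i ⟨j, hij.ne'⟩ : Fin p) : ℕ) = j + m - 1 := by
    simp [outerIdx, Fin.lt_def, hji]
  have v2 : ((outerIdx h₃ j ⟨i, hij.ne⟩ : Fin q) : ℕ) = i := by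
    simp [outerIdx, Fin.lt_def, hij']
  apply finset_ext_nat
  intro a
  simp only [substFace_iff, outerIdx_mem, v1, v2]
  have e1 : (j : ℕ) + m - 1 + n ≤ a → a + 1 - n + 1 - m = a + 1 - m + 1 - n := by omega
  have e2 : (j : ℕ) + m - 1 ≤ a → a - (j + m - 1) = a + 1 - m - j := by omega
  by_cases c1 : a < i + m
  · have d1 : a < j + m - 1 := by omega
    have d2 : ¬ (j : ℕ) + m - 1 ≤ a := by omega
    have d3 : ¬ (j : ℕ) + m - 1 + n ≤ a := by omega
    have d4 : ¬ (i : ℕ) + m ≤ a := by omega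
    have d5 : a < i → a < j := by omega
    have d6 : a < i → ¬ (j : ℕ) ≤ a := by omega
    have d7 : a < i → ¬ (j : ℕ) + n ≤ a := by omega
    by_cases c0 : a < i <;> simp [*]
  · have d1 : ¬ a < i := by omega
    have d2 : (i : ℕ) + m ≤ a := by omega
    simp only [c1, d1, d2, false_and, and_false, false_or, true_and]
    have d3 : a < j + m - 1 ↔ a + 1 - m < j := by omega
    have d4 : (j : ℕ) + m - 1 ≤ a ↔ j ≤ a + 1 - m := by omega
    have d5 : a < (j : ℕ) + m - 1 + n ↔ a + 1 - m < j + n := by omega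
    have d6 : (j : ℕ) + m - 1 + n ≤ a ↔ j + n ≤ a + 1 - m := by omega
    rw [d3, d5]
    by_cases c2 : (j : ℕ) + n ≤ a + 1 - m
    · have f1 : ¬ a + 1 - m < j := by omega
      have f2 : ¬ a + 1 - m < j + n := by omega
      have f3 : ¬ a + 1 - n < i := by omega
      have f4 : ¬ a + 1 - n < i + m := by omega
      have f5 : (i : ℕ) + m ≤ a + 1 - n := by omega
      simp [f1, f2, f3, f4, f5, d6, c2, e1 (d6.2 c2)]
    · by_cases c3 : (j : ℕ) ≤ a + 1 - m
      · simp [d4, d6, c2, c3, e2 (d4.2 c3)]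
      · simp [d4, d6, c2, c3]

theorem substFace_sequential {l m n p q r : ℕ} (h₁ : q + 1 = m + n) (h₂ : r + 1 = l + q)
    (h₃ : p + 1 = l + m) (h₄ : r + 1 = p + n) (i : Fin l) (j : Fin m)
    (A : Finset (Fin l)) (B : Finset (Fin m)) (C : Finset (Fin n)) :
    substFace h₂ i A (substFace h₁ j B C) =
      substFace h₄ (innerIdx h₃ i j) (substFace h₃ i A B) C := by
  have v1 : ((innerIdx h₃ i j : Fin p) : ℕ) = i + j := rfl
  apply finset_ext_nat
  intro a
  simp only [substFace_iff, innerIdx_mem, v1]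
  have hj := j.2
  by_cases c1 : a < i + j
  · have d1 : ¬ (i : ℕ) + j ≤ a := by omega
    have d2 : ¬ (i : ℕ) + j + n ≤ a := by omega
    have d3 : ¬ (i : ℕ) + q ≤ a := by omega
    have d4 : ¬ (i : ℕ) + m ≤ a := by omega
    have d7 : a < i + q := by omega
    have d8 : a < i + m := by omega
    by_cases c0 : a < i
    · have d9 : ¬ (i : ℕ) ≤ a := by omega
      simp [c0, c1, d1, d2, d3, d4, d9]
    · have d9 : (i : ℕ) ≤ a := by omega
      have d10 : a - i < j := by omega
      have d5 : ¬ (j : ℕ) ≤ a - i := by omega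
      have d6 : ¬ (j : ℕ) + n ≤ a - i := by omega
      simp [c0, c1, d1, d2, d3, d4, d5, d6, d7, d8, d9, d10]
  · have d1 : ¬ a < i := by omega
    have d2 : (i : ℕ) ≤ a := by omega
    have d3 : (i : ℕ) + j ≤ a := by omega
    have d4 : ¬ a - i < j := by omega
    have d5 : (j : ℕ) ≤ a - i := by omega
    by_cases c2 : a < i + j + n
    · have f1 : a < i + q := by omega
      have f2 : a - i < j + n := by omega
      have f3 : ¬ (j : ℕ) + n ≤ a - i := by omega
      have f4 : ¬ (i : ℕ) + q ≤ a := by omega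
      have f5 : ¬ (i : ℕ) + j + n ≤ a := by omega
      simp [c1, c2, d1, d2, d3, d4, d5, f1, f2, f3, f4, f5, Nat.sub_sub, and_assoc]
    · have f2 : ¬ a - i < j + n := by omega
      have f3 : (j : ℕ) + n ≤ a - i := by omega
      have f5 : (i : ℕ) + j + n ≤ a := by omega
      have f6 : ¬ a + 1 - n < i := by omega
      have f7 : (i : ℕ) ≤ a + 1 - n := by omega
      have f8 : a - i + 1 - n = a + 1 - n - i := by omega
      by_cases c3 : (i : ℕ) + q ≤ a
      · have g1 : ¬ a < i + q := by omega
        have g2 : ¬ a + 1 - n < i + m := by omega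
        have g3 : (i : ℕ) + m ≤ a + 1 - n := by omega
        have g4 : a + 1 - n + 1 - m = a + 1 - q := by omega
        simp [c1, c2, c3, d1, d2, d3, f5, f6, f7, g1, g2, g3, g4]
      · have g1 : a < i + q := by omega
        have g2 : a + 1 - n < i + m := by omega
        have g3 : ¬ (i : ℕ) + m ≤ a + 1 - n := by omega
        simp [c1, c2, c3, d1, d2, d3, d4, d5, f2, f3, f5, f6, f7, f8, g1, g2, g3]

theorem SCpx.ext_iff' {n : ℕ} {K L : SCpx n} (h : ∀ S, S ∈ K.faces ↔ S ∈ L.faces) : K = L :=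
  SCpx.ext (Set.ext h)

theorem permInsert_outer {n m p : ℕ} (h : p + 1 = n + m) (k : Fin n)
    (σ : Equiv.Perm (Fin n)) (τ : Equiv.Perm (Fin m)) (i : {i : Fin n // i ≠ k}) :
    permInsert h k σ τ (outerIdx h k i) =
      outerIdx h (σ k) ⟨σ i, fun e => i.2 (σ.injective e)⟩ := by
  have : (slotEquiv h k).symm (outerIdx h k i) = Sum.inl i :=
    (slotEquiv h k).symm_apply_apply (Sum.inl i)
  simp only [permInsert, Equiv.trans_apply, this]
  rfl

theorem permInsert_inner {n m p : ℕ} (h : p + 1 = n + m) (k : Fin n)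
    (σ : Equiv.Perm (Fin n)) (τ : Equiv.Perm (Fin m)) (j : Fin m) :
    permInsert h k σ τ (innerIdx h k j) = innerIdx h (σ k) (τ j) := by
  have : (slotEquiv h k).symm (innerIdx h k j) = Sum.inr j :=
    (slotEquiv h k).symm_apply_apply (Sum.inr j)
  simp only [permInsert, Equiv.trans_apply, this]
  rfl

theorem mem_map_perm {n : ℕ} (σ : Equiv.Perm (Fin n)) (S : Finset (Fin n)) (x : Fin n) :
    σ x ∈ S.map σ.toEmbedding ↔ x ∈ S := by
  simp

theorem map_substFace {n m p : ℕ} (h : p + 1 = n + m) (k : Fin n)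
    (σ : Equiv.Perm (Fin n)) (τ : Equiv.Perm (Fin m))
    (I : Finset (Fin n)) (J : Finset (Fin m)) :
    (substFace h k I J).map (permInsert h k σ τ).toEmbedding =
      substFace h (σ k) (I.map σ.toEmbedding) (J.map τ.toEmbedding) := by
  ext y
  obtain ⟨x, rfl⟩ := (permInsert h k σ τ).surjective y
  rw [mem_map_perm]
  rcases slot_cases h k x with ⟨i, rfl⟩ | ⟨j, rfl⟩
  · rw [permInsert_outer, outerIdx_mem, outerIdx_mem, mem_map_perm]
  · rw [permInsert_inner, innerIdx_mem, innerIdx_mem, mem_map_perm, mem_map_perm]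

theorem map_map_symm {n : ℕ} (σ : Equiv.Perm (Fin n)) (S : Finset (Fin n)) :
    (S.map σ.symm.toEmbedding).map σ.toEmbedding = S := by
  ext x
  simp

/-- The substitution operad `(scpx_{≠∅}, {∘_k})`. It has no operations of arity `0`. -/
noncomputable def substOperad : SetOperad.{0} where
  Op := SCpx
  perm := SCpx.perm
  comp := SCpx.subst
  one := SCpx.one
  perm_one A := SCpx.ext_iff' fun S => by
    have : S.map (Equiv.refl (Fin _)).toEmbedding = S := by ext x; simp
    change S.map (Equiv.refl (Fin _)).toEmbedding ∈ A.faces ↔ _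
    rw [this]
  perm_mul A σ τ := SCpx.ext_iff' fun S => by
    have : S.map (Equiv.toEmbedding (σ * τ)) = (S.map τ.toEmbedding).map σ.toEmbedding := by
      ext x
      obtain ⟨y, rfl⟩ := (σ * τ).surjective x
      rw [mem_map_perm, Equiv.Perm.mul_apply, mem_map_perm, mem_map_perm]
    change S.map (Equiv.toEmbedding (σ * τ)) ∈ A.faces ↔ (S.map τ.toEmbedding).map σ.toEmbedding ∈ A.faces
    rw [this]
  comp_perm h k A B σ τ := SCpx.ext_iff' fun S => by
    constructor
    · rintro ⟨I, hI, J, hJ, rfl⟩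
      exact ⟨_, hI, _, hJ, map_substFace h k σ τ I J⟩
    · rintro ⟨I, hI, J, hJ, e⟩
      refine ⟨I.map σ.symm.toEmbedding, ?_, J.map τ.symm.toEmbedding, ?_, ?_⟩
      · change (I.map σ.symm.toEmbedding).map σ.toEmbedding ∈ A.faces
        rwa [map_map_symm]
      · change (J.map τ.symm.toEmbedding).map τ.toEmbedding ∈ B.faces
        rwa [map_map_symm]
      · apply Finset.map_injective (permInsert h k σ τ).toEmbedding
        rw [e, map_substFace, map_map_symm, map_map_symm]
  parallel h₁ h₂ h₃ h₄ i j hij A B C := SCpx.ext_iff' fun S => by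
    constructor
    · rintro ⟨_, ⟨I, hI, J, hJ, rfl⟩, T, hT, rfl⟩
      exact ⟨_, ⟨I, hI, T, hT, rfl⟩, J, hJ, substFace_parallel h₁ h₂ h₃ h₄ i j hij I J T⟩
    · rintro ⟨_, ⟨I, hI, T, hT, rfl⟩, J, hJ, rfl⟩
      exact ⟨_, ⟨I, hI, J, hJ, rfl⟩, T, hT, (substFace_parallel h₁ h₂ h₃ h₄ i j hij I J T).symm⟩
  sequential h₁ h₂ h₃ h₄ i j A B C := SCpx.ext_iff' fun S => by
    constructor
    · rintro ⟨I, hI, _, ⟨J, hJ, T, hT, rfl⟩, rfl⟩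
      exact ⟨_, ⟨I, hI, J, hJ, rfl⟩, T, hT, substFace_sequential h₁ h₂ h₃ h₄ i j I J T⟩
    · rintro ⟨_, ⟨I, hI, J, hJ, rfl⟩, T, hT, rfl⟩
      exact ⟨I, hI, _, ⟨J, hJ, T, hT, rfl⟩, (substFace_sequential h₁ h₂ h₃ h₄ i j I J T).symm⟩
  one_comp {n} A := SCpx.ext_iff' fun S => by
    have key : ∀ J : Finset (Fin n), substFace (Nat.add_comm n 1) 0 {0} J = J := fun J => by
      apply finset_ext_nat
      intro a
      rw [substFace_iff]
      simp [NatMem]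
      grind
    have key' : ∀ J : Finset (Fin n), substFace (Nat.add_comm n 1) (0 : Fin 1) ∅ J = ∅ :=
      fun J => by simp [substFace]
    constructor
    · rintro ⟨I, rfl | rfl, J, hJ, rfl⟩
      · rw [key']; exact A.empty_mem
      · rw [key]; exact hJ
    · intro hS
      exact ⟨{0}, Or.inr rfl, S, hS, (key S).symm⟩
  comp_one {n} k A := SCpx.ext_iff' fun S => by
    have key : ∀ I : Finset (Fin n), substFace rfl k I ({0} : Finset (Fin 1)) = I := fun I => by
      apply finset_ext_nat
      intro a
      rw [substFace_iff, mem_iff_nat I k]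
      simp [NatMem]
      grind
    have key' : ∀ I : Finset (Fin n), substFace rfl k I (∅ : Finset (Fin 1)) ⊆ I := fun I => by
      intro x hx
      rw [mem_iff_nat] at hx ⊢
      rw [substFace_iff] at hx
      simp [NatMem] at hx ⊢
      grind
    constructor
    · rintro ⟨I, hI, J, rfl | rfl, rfl⟩
      · exact A.down_closed hI (key' I)
      · rw [key]; exact hI
    · intro hS
      exact ⟨S, hS, {0}, Or.inr rfl, (key S).symm⟩

/-! ## Finite tensor products in monoidal categories -/

section Tensor

variable {C : Type u} [Category.{v} C] [MonoidalCategory C]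

/-- The tensor product `Z_1 ⊗ (Z_2 ⊗ (⋯ ⊗ (Z_n ⊗ e)))`. -/
def tensorFin : ∀ (n : ℕ), (Fin n → C) → C
  | 0, _ => 𝟙_ C
  | n + 1, Z => Z 0 ⊗ tensorFin n (fun i => Z i.succ)

/-- The tensor product of a finite sequence of morphisms. -/
def tensorFinMap : ∀ (n : ℕ) {Z W : Fin n → C}, (∀ i, Z i ⟶ W i) →
    (tensorFin n Z ⟶ tensorFin n W)
  | 0, _, _, _ => 𝟙 _
  | n + 1, _, _, g => g 0 ⊗ₘ tensorFinMap n (fun i => g i.succ)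

theorem tensorFinMap_id : ∀ (n : ℕ) (Z : Fin n → C),
    tensorFinMap n (fun i => 𝟙 (Z i)) = 𝟙 (tensorFin n Z)
  | 0, _ => rfl
  | n + 1, Z => by
    have := tensorFinMap_id n (fun i => Z i.succ)
    simp only [tensorFinMap, this]
    exact id_tensorHom_id _ _

theorem tensorFinMap_comp : ∀ (n : ℕ) {Z W V : Fin n → C} (g : ∀ i, Z i ⟶ W i)
    (g' : ∀ i, W i ⟶ V i),
    tensorFinMap n (fun i => g i ≫ g' i) = tensorFinMap n g ≫ tensorFinMap n g'
  | 0, _, _, _, _, _ => (Category.id_comp _).symm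
  | n + 1, _, _, _, g, g' => by
    have := tensorFinMap_comp n (fun i => g i.succ) (fun i => g' i.succ)
    simp only [tensorFinMap, this]
    exact (tensorHom_comp_tensorHom _ _ _ _).symm

/-- The tensor product of a finite sequence of isomorphisms. -/
def tensorFinIso (n : ℕ) {Z W : Fin n → C} (g : ∀ i, Z i ≅ W i) :
    tensorFin n Z ≅ tensorFin n W where
  hom := tensorFinMap n (fun i => (g i).hom)
  inv := tensorFinMap n (fun i => (g i).inv)
  hom_inv_id := by rw [← tensorFinMap_comp]; simp [tensorFinMap_id]
  inv_hom_id := by rw [← tensorFinMap_comp]; simp [tensorFinMap_id]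

/-- The canonical associativity isomorphism
`(X_1 ⊗ ⋯ ⊗ X_m) ⊗ (Y_1 ⊗ ⋯ ⊗ Y_n) ≅ Z_1 ⊗ ⋯ ⊗ Z_{m+n}`, where `Z` is the concatenation of the
sequences `X` and `Y` (up to given isomorphisms). -/
def appendIso : ∀ (m n p : ℕ) (h : m + n = p) (X : Fin m → C) (Y : Fin n → C) (Z : Fin p → C)
    (_ : ∀ i : Fin m, X i ≅ Z ⟨i, by omega⟩) (_ : ∀ j : Fin n, Y j ≅ Z ⟨m + j, by omega⟩),
    tensorFin m X ⊗ tensorFin n Y ≅ tensorFin p Z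
  | 0, n, p, h, _, Y, Z, _, eY => by
    obtain rfl : n = p := by omega
    exact λ_ _ ≪≫ tensorFinIso n (fun j => eY j ≪≫ eqToIso (congrArg Z (Fin.ext (by simp))))
  | m + 1, n, 0, h, _, _, _, _, _ => absurd h (by omega)
  | m + 1, n, p + 1, h, X, Y, Z, eX, eY =>
    α_ _ _ _ ≪≫ (eX 0 ⊗ᵢ
      appendIso m n p (by omega) (fun i => X i.succ) Y (fun i => Z i.succ)
        (fun i => eX i.succ)
        (fun j => eY j ≪≫ eqToIso (congrArg Z (Fin.ext (by simp; omega)))))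

/-- The canonical associativity isomorphism
`Z_1 ⊗ ⋯ ⊗ Z_{k-1} ⊗ (Z_k ⊗ ⋯ ⊗ Z_{k+m-1}) ⊗ Z_{k+m} ⊗ ⋯ ⊗ Z_{n+m-1} ≅ Z_1 ⊗ ⋯ ⊗ Z_{n+m-1}`.
The factors `W_1, …, W_n` of the left hand side are given up to isomorphism. -/
def insertIso : ∀ (n m p : ℕ) (h : p + 1 = n + m) (k : Fin n) (W : Fin n → C) (Z : Fin p → C)
    (_ : W k ≅ tensorFin m (fun j => Z (innerIdx h k j)))
    (_ : ∀ i : {i : Fin n // i ≠ k}, W i ≅ Z (outerIdx h k i)),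
    tensorFin n W ≅ tensorFin p Z
  | n + 1, m, p, h, ⟨0, hk⟩, W, Z, ek, eo =>
    (ek ⊗ᵢ Iso.refl (tensorFin n (fun i => W i.succ))) ≪≫
      appendIso m n p (by omega) _ _ Z
        (fun j => eqToIso (congrArg Z (Fin.ext (by simp [innerIdx]))))
        (fun i => eo ⟨i.succ, Fin.succ_ne_zero i⟩ ≪≫
          eqToIso (congrArg Z (Fin.ext (by simp [outerIdx]; omega))))
  | n + 1, m, 0, h, ⟨k + 1, hk⟩, _, _, _, _ => absurd h (by omega)
  | n + 1, m, p + 1, h, ⟨k + 1, hk⟩, W, Z, ek, eo =>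
    (eo ⟨0, by simp [Fin.ext_iff]⟩ ≪≫
        eqToIso (congrArg Z (Fin.ext (by simp [outerIdx])))) ⊗ᵢ
      insertIso n m p (by omega) ⟨k, by omega⟩ (fun i => W i.succ) (fun i => Z i.succ)
        (ek ≪≫ tensorFinIso m (fun j => eqToIso (congrArg Z (Fin.ext (by
          simp [innerIdx]; omega)))))
        (fun i => eo ⟨i.1.succ, fun e => i.2 (Fin.succ_injective _ e)⟩ ≪≫
          eqToIso (congrArg Z (Fin.ext (by
            have h1 : (i.1 : ℕ) ≠ k := fun e => i.2 (Fin.ext e)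
            by_cases h2 : (i.1 : ℕ) < k <;> simp [outerIdx, Fin.lt_def, h2]; omega))))

variable [SymmetricCategory C]

/-- The canonical symmetry isomorphism moving the factor `Z_j` to the front. -/
def extractIso : ∀ (n : ℕ) (j : Fin (n + 1)) (Z : Fin (n + 1) → C),
    Z j ⊗ tensorFin n (fun i => Z (j.succAbove i)) ≅ tensorFin (n + 1) Z
  | n, ⟨0, _⟩, Z =>
    Iso.refl (Z 0) ⊗ᵢ tensorFinIso n (fun i => eqToIso (congrArg Z (Fin.zero_succAbove i)))
  | 0, ⟨j + 1, hj⟩, _ => absurd hj (by omega)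
  | n + 1, ⟨j + 1, hj⟩, Z =>
    (α_ _ _ _).symm ≪≫ (β_ _ _ ⊗ᵢ Iso.refl _) ≪≫ α_ _ _ _ ≪≫
      (eqToIso (congrArg Z (Fin.succ_succAbove_zero ⟨j, by omega⟩)) ⊗ᵢ
        ((Iso.refl _ ⊗ᵢ tensorFinIso n (fun i => eqToIso (congrArg Z
          (Fin.succ_succAbove_succ ⟨j, by omega⟩ i)))) ≪≫
          extractIso n ⟨j, by omega⟩ (fun i => Z i.succ)))

/-- The permutation of `[n]` obtained from a permutation `σ` of `[n + 1]` by deleting the first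
element from the source and its image from the target. -/
def permTail {n : ℕ} (σ : Equiv.Perm (Fin (n + 1))) : Equiv.Perm (Fin n) :=
  (finSuccAboveEquiv 0).trans
    ((σ.subtypeEquiv (p := fun i => i ≠ 0) (q := fun i => i ≠ σ 0) (fun _ => by simp)).trans
      (finSuccAboveEquiv (σ 0)).symm)

theorem succAbove_permTail {n : ℕ} (σ : Equiv.Perm (Fin (n + 1))) (i : Fin n) :
    (σ 0).succAbove (permTail σ i) = σ i.succ := by
  have := (finSuccAboveEquiv (σ 0)).apply_symm_apply
    ((σ.subtypeEquiv (p := fun i => i ≠ 0) (q := fun i => i ≠ σ 0) (fun _ => by simp))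
      (finSuccAboveEquiv 0 i))
  exact congrArg Subtype.val this

/-- The canonical symmetry isomorphism
`Z_{σ(1)} ⊗ ⋯ ⊗ Z_{σ(n)} ≅ Z_1 ⊗ ⋯ ⊗ Z_n`. -/
def permIso : ∀ (n : ℕ) (σ : Equiv.Perm (Fin n)) (Z : Fin n → C),
    tensorFin n (fun i => Z (σ i)) ≅ tensorFin n Z
  | 0, _, _ => Iso.refl _
  | n + 1, σ, Z =>
    (Iso.refl (Z (σ 0)) ⊗ᵢ
      (tensorFinIso n (fun i => eqToIso (congrArg Z (succAbove_permTail σ i).symm)) ≪≫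
        permIso n (permTail σ) (fun i => Z ((σ 0).succAbove i)))) ≪≫
      extractIso n (σ 0) Z

end Tensor

/-! ## Cubical functors and polyhedral product maps -/

section Polyhedral

variable {C : Type u} [Category.{v} C]

/-- The target of the arrow `g` if the truth value is `true`, and its source otherwise. -/
def edgeObj (g : Arrow C) : Bool → C
  | true => g.right
  | false => g.left

/-- An arrow `g : Y ⟶ X` seen as a diagram `Y ⟶ X` indexed by the order `false ≤ true`. -/
def edgeMap (g : Arrow C) : ∀ {a b : Bool}, a ≤ b → (edgeObj g a ⟶ edgeObj g b)
  | false, false, _ => 𝟙 g.left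
  | false, true, _ => g.hom
  | true, true, _ => 𝟙 g.right
  | true, false, h => absurd h (by decide)

theorem edgeMap_id (g : Arrow C) (a : Bool) (h : a ≤ a) : edgeMap g h = 𝟙 (edgeObj g a) := by
  cases a <;> rfl

theorem edgeMap_comp (g : Arrow C) {a b c : Bool} (h : a ≤ b) (h' : b ≤ c) :
    edgeMap g (h.trans h') = edgeMap g h ≫ edgeMap g h' := by
  revert h h'
  cases a <;> cases b <;> cases c <;> intro h h' <;>
    first
      | exact absurd h (by decide)
      | exact absurd h' (by decide)
      | exact (Category.id_comp _).symm
      | exact (Category.comp_id _).symm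

theorem decide_mem_le {n : ℕ} {I J : Finset (Fin n)} (h : I ⊆ J) (i : Fin n) :
    decide (i ∈ I) ≤ decide (i ∈ J) := by
  by_cases hi : i ∈ I
  · simp [hi, h hi]
  · simp [hi]

variable [MonoidalCategory C]

/-- The cubical functor of a sequence of arrows `f_i : Y_i ⟶ X_i`: it sends `I ⊆ [n]` to the
tensor product of the `X_i`, for `i ∈ I`, and of the `Y_i`, for `i ∉ I` (in the order of `[n]`), and
an inclusion `I ⊆ J` to the tensor product of the `f_i`, for `i ∈ J \ I`, and of identities. -/
def cubical {n : ℕ} (f : Fin n → Arrow C) : Finset (Fin n) ⥤ C where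
  obj I := tensorFin n (fun i => edgeObj (f i) (decide (i ∈ I)))
  map φ := tensorFinMap n (fun i => edgeMap (f i) (decide_mem_le (leOfHom φ) i))
  map_id I := by simp only [edgeMap_id, tensorFinMap_id]
  map_comp φ ψ := by
    rw [← tensorFinMap_comp]
    congr 1
    funext i
    exact edgeMap_comp _ _ _

/-- The face category of a simplicial complex: its faces, ordered by inclusion. -/
abbrev SCpx.FaceCat {n : ℕ} (K : SCpx n) : Type := {I : Finset (Fin n) // I ∈ K.faces}

noncomputable instance {n : ℕ} (K : SCpx n) : Fintype K.FaceCat := Fintype.ofFinite _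

/-- The inclusion of the face category into the Boolean lattice of subsets of `[n]`. -/
def SCpx.incl {n : ℕ} (K : SCpx n) : K.FaceCat ⥤ Finset (Fin n) :=
  Monotone.functor (f := fun I : K.FaceCat => I.1) (fun _ _ h => h)

/-- The canonical identification of `Y_1 ⊗ ⋯ ⊗ Y_n` with the value at the face `∅` of the cubical
functor. -/
def cubicalEmptyIso {n : ℕ} (K : SCpx n) (f : Fin n → Arrow C) :
    tensorFin n (fun i => (f i).left) ≅ (K.incl ⋙ cubical f).obj ⟨∅, K.empty_mem⟩ :=
  tensorFinIso n (W := fun i => edgeObj (f i) (decide (i ∈ (∅ : Finset (Fin n)))))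
    (fun i => eqToIso (by simp [edgeObj]))

variable [HasFiniteColimits C]

/-- The polyhedral product map: the canonical morphism from `Y_1 ⊗ ⋯ ⊗ Y_n` to the colimit of the
cubical functor over the face category of `K`. -/
noncomputable def polyMap {n : ℕ} (K : SCpx n) (f : Fin n → Arrow C) : Arrow C :=
  Arrow.mk (Y := colimit (K.incl ⋙ cubical f))
    ((cubicalEmptyIso K f).hom ≫ colimit.ι (K.incl ⋙ cubical f) ⟨∅, K.empty_mem⟩)

/-- The canonical isomorphism between the sources of the two composites of polyhedral product
maps `(K; f_1, …, f_{k-1}, (L; f_k, …, f_{k+m-1}), f_{k+m}, …, f_{n+m-1})` and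
`(K ∘_k L; f_1, …, f_{n+m-1})`. -/
noncomputable def sourceIso {n m p : ℕ} (h : p + 1 = n + m) (k : Fin n) (K : SCpx n) (L : SCpx m)
    (f : Fin p → Arrow C) :
    (polyMap K (graft h k (polyMap L (f ∘ innerIdx h k)) f)).left ≅
      (polyMap (K.subst h k L) f).left :=
  insertIso n m p h k
    (fun i => (graft h k (polyMap L (f ∘ innerIdx h k)) f i).left) (fun i => (f i).left)
    (eqToIso (by simp [graft]; rfl))
    (fun i => eqToIso (by simp [graft, i.2]))

end Polyhedral

end PolyProd

/-!
The polyhedral product map of `K` is natural in everything that enters it, so each part reduces to an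
identification of the two colimits that is compatible with a canonical isomorphism of tensor products.

*Naturality.* The coherence isomorphisms `insertIso` and `permIso` are natural in the factors
(`insertIso_naturality`, `permIso_naturality`). To compare factors, an arrow is viewed as a functor
of a truth value; `edgeHom` is this evaluation as a functor of the arrow and of the truth value at
once, so that all comparisons of factors are equalities between morphisms of arrows.

*Equivariance and unit.* For a permutation, `S ↦ σ(S)` is an isomorphism between the face posets, and
`permIso` is a natural isomorphism over it. The complex `{∅, {1}}` has a largest face, so its colimit
is the value there.

*Substitution.* The map `Y ⟶ colim_J z(J)` is itself the colimit, in the category of arrows, of the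
arrows `Y ⟶ z(J)` over the faces `J` of `L` (`blockCocone`). Grafting the latter at position `k` and
evaluating the cubical functor at `I` gives `z(I ∘_k J)` up to `insertIso` (`substIso`). For fixed `I`
these objects have as colimit over `J` the value at `I` of the cubical functor of the sequence with
`Y ⟶ colim_J z(J)` at position `k`: if `k ∈ I` because the tensor product preserves finite colimits,
and if `k ∉ I` because the diagram is constant up to isomorphism and has an initial index
(`nonempty_isColimit_graftLeg`). Hence the colimit over `I ∈ K` is an iterated colimit over `K × L`.
Substitution of faces `K × L → K ∘_k L` has a left adjoint (`subset_substFace_iff`), so it is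
final, and the iterated colimit is the colimit over `K ∘_k L` (`exists_colimit_iso_of_rows`).

The algebra structure on isomorphism classes follows, since polyhedral product maps respect
isomorphisms of arrows (`polyMapIso`).
-/

namespace PolyProd

/-! ### Naturality of the canonical isomorphisms -/

section TensorNaturality

variable {C : Type u} [Category.{v} C] [MonoidalCategory C]

theorem tensorFinIso_hom (n : ℕ) {Z W : Fin n → C} (g : ∀ i, Z i ≅ W i) :
    (tensorFinIso n g).hom = tensorFinMap n (fun i => (g i).hom) := rfl

theorem tensorFinMap_isIso (n : ℕ) {Z W : Fin n → C} (g : ∀ i, Z i ⟶ W i) (hg : ∀ i, IsIso (g i)) :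
    IsIso (tensorFinMap n g) :=
  (tensorFinIso n (fun i => @asIso _ _ _ _ (g i) (hg i))).isIso_hom

/-! The squares below express the naturality of one step of the recursive definitions of the
canonical isomorphisms. -/

section Squares

variable {A A' B B' D D' P P' Q Q' : C}

theorem tensorHom_square {a : A ⟶ A'} {b : B ⟶ B'} {u : A ⟶ P} {u' : A' ⟶ P'} {v : B ⟶ Q}
    {v' : B' ⟶ Q'} {r : P ⟶ P'} {q : Q ⟶ Q'} (hu : a ≫ u' = u ≫ r) (hv : b ≫ v' = v ≫ q) :
    (a ⊗ₘ b) ≫ (u' ⊗ₘ v') = (u ⊗ₘ v) ≫ (r ⊗ₘ q) := by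
  rw [tensorHom_comp_tensorHom, tensorHom_comp_tensorHom, hu, hv]

theorem leftUnitor_square {b : B ⟶ B'} {v : B ⟶ Q} {v' : B' ⟶ Q'} {q : Q ⟶ Q'}
    (hv : b ≫ v' = v ≫ q) :
    (𝟙 (𝟙_ C) ⊗ₘ b) ≫ (λ_ B').hom ≫ v' = ((λ_ B).hom ≫ v) ≫ q := by
  simp [hv]

theorem associator_square {a : A ⟶ A'} {b : B ⟶ B'} {d : D ⟶ D'} {u : A ⟶ P} {u' : A' ⟶ P'}
    {v : B ⊗ D ⟶ Q} {v' : B' ⊗ D' ⟶ Q'} {r : P ⟶ P'} {q : Q ⟶ Q'}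
    (hu : a ≫ u' = u ≫ r) (hv : (b ⊗ₘ d) ≫ v' = v ≫ q) :
    ((a ⊗ₘ b) ⊗ₘ d) ≫ (α_ A' B' D').hom ≫ (u' ⊗ₘ v') =
      ((α_ A B D).hom ≫ (u ⊗ₘ v)) ≫ (r ⊗ₘ q) := by
  rw [associator_naturality_assoc, tensorHom_square hu hv, Category.assoc]

theorem tensorHom_id_square {a : A ⟶ A'} {b : B ⟶ B'} {u : A ⟶ P} {u' : A' ⟶ P'} {r : P ⟶ P'}
    {v : P ⊗ B ⟶ Q} {v' : P' ⊗ B' ⟶ Q'} {q : Q ⟶ Q'}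
    (hu : a ≫ u' = u ≫ r) (hv : (r ⊗ₘ b) ≫ v' = v ≫ q) :
    (a ⊗ₘ b) ≫ (u' ⊗ₘ 𝟙 B') ≫ v' = ((u ⊗ₘ 𝟙 B) ≫ v) ≫ q := by
  rw [Category.assoc, ← hv, tensorHom_comp_tensorHom_assoc, tensorHom_comp_tensorHom_assoc, hu,
    Category.comp_id, Category.id_comp]

theorem id_tensorHom_square {a : A ⟶ A'} {b : B ⟶ B'} {u : B ⟶ P} {u' : B' ⟶ P'} {r : P ⟶ P'}
    {v : A ⊗ P ⟶ Q} {v' : A' ⊗ P' ⟶ Q'} {q : Q ⟶ Q'}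
    (hu : b ≫ u' = u ≫ r) (hv : (a ⊗ₘ r) ≫ v' = v ≫ q) :
    (a ⊗ₘ b) ≫ (𝟙 A' ⊗ₘ u') ≫ v' = ((𝟙 A ⊗ₘ u) ≫ v) ≫ q := by
  rw [Category.assoc, ← hv, tensorHom_comp_tensorHom_assoc, tensorHom_comp_tensorHom_assoc, hu,
    Category.comp_id, Category.id_comp]

theorem braiding_square [BraidedCategory C] {a : A ⟶ A'} {b : B ⟶ B'} {d : D ⟶ D'} {u : B ⟶ P}
    {u' : B' ⟶ P'} {v : A ⊗ D ⟶ Q} {v' : A' ⊗ D' ⟶ Q'} {r : P ⟶ P'} {q : Q ⟶ Q'}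
    (hu : b ≫ u' = u ≫ r) (hv : (a ⊗ₘ d) ≫ v' = v ≫ q) :
    (a ⊗ₘ (b ⊗ₘ d)) ≫ (α_ A' B' D').inv ≫ ((β_ A' B').hom ⊗ₘ 𝟙 D') ≫ (α_ B' A' D').hom ≫
        (u' ⊗ₘ v') =
      ((α_ A B D).inv ≫ ((β_ A B).hom ⊗ₘ 𝟙 D) ≫ (α_ B A D).hom ≫ (u ⊗ₘ v)) ≫ (r ⊗ₘ q) := by
  simp only [Category.assoc]
  rw [← tensorHom_square hu hv, associator_inv_naturality_assoc, tensorHom_comp_tensorHom_assoc,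
    BraidedCategory.braiding_naturality, Category.comp_id, ← associator_naturality_assoc,
    tensorHom_comp_tensorHom_assoc, Category.id_comp]

end Squares

omit [MonoidalCategory C] in
theorem comp_eqToHom_square {ι : Type*} {Z Z' : ι → C} (z : ∀ i, Z i ⟶ Z' i) {X X' : C} {i j : ι}
    {x : X ⟶ X'} {e : X ⟶ Z i} {e' : X' ⟶ Z' i} (h : x ≫ e' = e ≫ z i) (w : i = j) :
    x ≫ e' ≫ eqToHom (congrArg Z' w) = (e ≫ eqToHom (congrArg Z w)) ≫ z j := by
  subst w
  simpa using h

theorem tensorFinMap_square (n : ℕ) {Z Z' W W' : Fin n → C} {z : ∀ i, Z i ⟶ Z' i}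
    {w : ∀ i, W i ⟶ W' i} {u : ∀ i, Z i ⟶ W i} {u' : ∀ i, Z' i ⟶ W' i}
    (h : ∀ i, z i ≫ u' i = u i ≫ w i) :
    tensorFinMap n z ≫ tensorFinMap n u' = tensorFinMap n u ≫ tensorFinMap n w := by
  rw [← tensorFinMap_comp, ← tensorFinMap_comp, funext h]

/-- The canonical isomorphism of a concatenation is natural in the factors. -/
theorem appendIso_naturality : ∀ (m n p : ℕ) (h : m + n = p) {X X' : Fin m → C} {Y Y' : Fin n → C}
    {Z Z' : Fin p → C}
    (eX : ∀ i : Fin m, X i ≅ Z ⟨i, by omega⟩) (eY : ∀ j : Fin n, Y j ≅ Z ⟨m + j, by omega⟩)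
    (eX' : ∀ i : Fin m, X' i ≅ Z' ⟨i, by omega⟩) (eY' : ∀ j : Fin n, Y' j ≅ Z' ⟨m + j, by omega⟩)
    (x : ∀ i, X i ⟶ X' i) (y : ∀ j, Y j ⟶ Y' j) (z : ∀ i, Z i ⟶ Z' i)
    (_ : ∀ i, x i ≫ (eX' i).hom = (eX i).hom ≫ z _)
    (_ : ∀ j, y j ≫ (eY' j).hom = (eY j).hom ≫ z _),
    (tensorFinMap m x ⊗ₘ tensorFinMap n y) ≫ (appendIso m n p h X' Y' Z' eX' eY').hom =
      (appendIso m n p h X Y Z eX eY).hom ≫ tensorFinMap p z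
  | 0, n, p, h, X, X', Y, Y', Z, Z', eX, eY, eX', eY', x, y, z, hx, hy => by
    obtain rfl : n = p := by omega
    exact leftUnitor_square (tensorFinMap_square n fun j =>
      comp_eqToHom_square z (hy j) (Fin.ext (by simp)))
  | m + 1, n, 0, h, _, _, _, _, _, _, _, _, _, _, _, _, _, _, _ => absurd h (by omega)
  | m + 1, n, p + 1, h, X, X', Y, Y', Z, Z', eX, eY, eX', eY', x, y, z, hx, hy =>
    associator_square (hx 0) (appendIso_naturality m n p (by omega) (fun i => eX i.succ) _
      (fun i => eX' i.succ) _ (fun i => x i.succ) y (fun i => z i.succ) (fun i => hx i.succ)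
      (fun j => comp_eqToHom_square z (hy j) (Fin.ext (by simp; omega))))

/-- The canonical isomorphism of an inserted block is natural in the factors. -/
theorem insertIso_naturality : ∀ (n m p : ℕ) (h : p + 1 = n + m) (k : Fin n) {W W' : Fin n → C}
    {Z Z' : Fin p → C}
    (ek : W k ≅ tensorFin m (fun j => Z (innerIdx h k j)))
    (eo : ∀ i : {i : Fin n // i ≠ k}, W i ≅ Z (outerIdx h k i))
    (ek' : W' k ≅ tensorFin m (fun j => Z' (innerIdx h k j)))
    (eo' : ∀ i : {i : Fin n // i ≠ k}, W' i ≅ Z' (outerIdx h k i))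
    (w : ∀ i, W i ⟶ W' i) (z : ∀ i, Z i ⟶ Z' i)
    (_ : w k ≫ ek'.hom = ek.hom ≫ tensorFinMap m (fun j => z (innerIdx h k j)))
    (_ : ∀ i, w i.1 ≫ (eo' i).hom = (eo i).hom ≫ z _),
    tensorFinMap n w ≫ (insertIso n m p h k W' Z' ek' eo').hom =
      (insertIso n m p h k W Z ek eo).hom ≫ tensorFinMap p z
  | n + 1, m, p, h, ⟨0, hk⟩, W, W', Z, Z', ek, eo, ek', eo', w, z, hwk, hwo =>
    tensorHom_id_square hwk (appendIso_naturality m n p (by omega) _ _ _ _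
      (fun j => z (innerIdx h ⟨0, hk⟩ j)) (fun i => w i.succ) z
      (fun j => eqToHom_naturality z (show innerIdx h ⟨0, hk⟩ j = ⟨j, by omega⟩ from
        Fin.ext (by simp [innerIdx])))
      (fun i => comp_eqToHom_square z (hwo ⟨i.succ, Fin.succ_ne_zero i⟩)
        (Fin.ext (by simp [outerIdx]; omega))))
  | n + 1, m, 0, h, ⟨k + 1, hk⟩, _, _, _, _, _, _, _, _, _, _, _, _ => absurd h (by omega)
  | n + 1, m, p + 1, h, ⟨k + 1, hk⟩, W, W', Z, Z', ek, eo, ek', eo', w, z, hwk, hwo => by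
    have h₀ : (0 : Fin (n + 1)) ≠ ⟨k + 1, hk⟩ := by simp [Fin.ext_iff]
    have e₀ : outerIdx h ⟨k + 1, hk⟩ ⟨0, h₀⟩ = 0 :=
      Fin.ext (by simp [outerIdx])
    refine tensorHom_square (comp_eqToHom_square z (hwo ⟨0, h₀⟩) e₀)
      (insertIso_naturality n m p (by omega) ⟨k, by omega⟩ _ _ _ _ (fun i => w i.succ)
        (fun i => z i.succ) ?_ fun i => ?_)
    · have e₁ : ∀ j : Fin m, innerIdx h ⟨k + 1, hk⟩ j =
          (innerIdx (by omega : p + 1 = n + m) ⟨k, by omega⟩ j).succ := fun j =>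
        Fin.ext (by simp [innerIdx]; omega)
      refine (Category.assoc _ _ _).symm.trans ((congrArg (· ≫ _) hwk).trans ?_)
      refine (Category.assoc _ _ _).trans (Eq.trans ?_ (Category.assoc _ _ _).symm)
      refine congrArg (ek.hom ≫ ·) (tensorFinMap_square m fun j => ?_)
      exact eqToHom_naturality z (e₁ j)
    · have h1 : (i.1 : ℕ) ≠ k := fun e => i.2 (Fin.ext e)
      have e₂ : outerIdx h ⟨k + 1, hk⟩ ⟨i.1.succ, fun e => i.2 (Fin.succ_injective _ e)⟩ =
          (outerIdx (by omega : p + 1 = n + m) ⟨k, by omega⟩ i).succ :=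
        Fin.ext (by by_cases h2 : (i.1 : ℕ) < k <;> simp [outerIdx, Fin.lt_def, h2]; omega)
      exact comp_eqToHom_square z (hwo ⟨i.1.succ, fun e => i.2 (Fin.succ_injective _ e)⟩) e₂

variable [SymmetricCategory C]

theorem extractIso_naturality : ∀ (n : ℕ) (j : Fin (n + 1)) {Z Z' : Fin (n + 1) → C}
    (z : ∀ i, Z i ⟶ Z' i),
    (z j ⊗ₘ tensorFinMap n (fun i => z (j.succAbove i))) ≫ (extractIso n j Z').hom =
      (extractIso n j Z).hom ≫ tensorFinMap (n + 1) z
  | n, ⟨0, h⟩, Z, Z', z => by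
    have key := tensorHom_square (a := z 0) (r := z 0)
      ((Category.comp_id _).trans (Category.id_comp _).symm)
      (tensorFinMap_square n fun i => eqToHom_naturality z (Fin.zero_succAbove i))
    -- The recursive definition of `extractIso` reduces only once `n` is a constructor.
    cases n <;> exact key
  | 0, ⟨j + 1, hj⟩, _, _, _ => absurd hj (by omega)
  | n + 1, ⟨j + 1, hj⟩, Z, Z', z => by
    have hj' : j < n + 1 := by omega
    refine braiding_square (eqToHom_naturality z (Fin.succ_succAbove_zero ⟨j, hj'⟩))
      (id_tensorHom_square (tensorFinMap_square n fun i => ?_)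
        (extractIso_naturality n ⟨j, hj'⟩ (fun i => z i.succ)))
    exact eqToHom_naturality z (Fin.succ_succAbove_succ ⟨j, hj'⟩ i)

/-- The canonical symmetry isomorphism is natural in the factors. -/
theorem permIso_naturality : ∀ (n : ℕ) (σ : Equiv.Perm (Fin n)) {Z Z' : Fin n → C}
    (z : ∀ i, Z i ⟶ Z' i),
    tensorFinMap n (fun i => z (σ i)) ≫ (permIso n σ Z').hom =
      (permIso n σ Z).hom ≫ tensorFinMap n z
  | 0, _, _, _, _ => (Category.comp_id _).trans (Category.id_comp _).symm
  | n + 1, σ, Z, Z', z => by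
    refine id_tensorHom_square (r := tensorFinMap n fun i => z ((σ 0).succAbove i)) ?_
      (extractIso_naturality n (σ 0) z)
    have ih := permIso_naturality n (permTail σ) (fun i => z ((σ 0).succAbove i))
    simp only [Iso.trans_hom, Category.assoc, ← ih, tensorFinIso_hom]
    rw [← Category.assoc, ← Category.assoc]
    congr 1
    exact tensorFinMap_square n fun i => eqToHom_naturality z (succAbove_permTail σ i).symm

end TensorNaturality

/-! ### Evaluation of arrows at truth values -/

section Edge

variable {C : Type u} [Category.{v} C]

/-- The morphism `edgeObj g a ⟶ edgeObj g' b` induced by a morphism of arrows `g ⟶ g'` and an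
inequality `a ≤ b`: the evaluation of arrows at truth values, as a functor of both variables. -/
def edgeHom {g g' : Arrow C} (φ : g ⟶ g') : ∀ {a b : Bool}, a ≤ b → (edgeObj g a ⟶ edgeObj g' b)
  | false, false, _ => φ.left
  | false, true, _ => g.hom ≫ φ.right
  | true, true, _ => φ.right
  | true, false, h => absurd h (by decide)

theorem edgeHom_id (g : Arrow C) {a b : Bool} (h : a ≤ b) : edgeHom (𝟙 g) h = edgeMap g h := by
  revert h
  cases a <;> cases b <;> intro h <;>
    first
      | exact absurd h (by decide)
      | rfl
      | exact Category.comp_id _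

theorem edgeHom_comp {g g' g'' : Arrow C} (φ : g ⟶ g') (ψ : g' ⟶ g'') {a b c : Bool}
    (h : a ≤ b) (h' : b ≤ c) :
    edgeHom φ h ≫ edgeHom ψ h' = edgeHom (φ ≫ ψ) (h.trans h') := by
  revert h h'
  cases a <;> cases b <;> cases c <;> intro h h' <;>
    first
      | exact absurd h (by decide)
      | exact absurd h' (by decide)
      | exact (Arrow.comp_left φ ψ).symm
      | exact (Arrow.comp_right φ ψ).symm
      | exact Arrow.w_assoc φ ψ.right
      | exact Category.assoc _ _ _

theorem edgeHom_id_refl (g : Arrow C) (a : Bool) (h : a ≤ a) :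
    edgeHom (𝟙 g) h = 𝟙 (edgeObj g a) := by
  rw [edgeHom_id, edgeMap_id]

theorem eqToHom_edgeObj {g g' : Arrow C} (e : g = g') {a b : Bool} (h : a = b)
    (w : edgeObj g a = edgeObj g' b) : eqToHom w = edgeHom (eqToHom e) h.le := by
  subst e h
  exact (edgeHom_id_refl _ _ _).symm

/-- The isomorphism `edgeObj g a ≅ edgeObj g' b` induced by an isomorphism of arrows `g ≅ g'` and
an equality `a = b`. -/
def edgeIso {g g' : Arrow C} (e : g ≅ g') {a b : Bool} (h : a = b) : edgeObj g a ≅ edgeObj g' b where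
  hom := edgeHom e.hom h.le
  inv := edgeHom e.inv h.ge
  hom_inv_id := by rw [edgeHom_comp, e.hom_inv_id, edgeHom_id_refl]
  inv_hom_id := by rw [edgeHom_comp, e.inv_hom_id, edgeHom_id_refl]

/-- The evaluation of arrows at a truth value. -/
def edgeFunctor (C : Type u) [Category.{v} C] (a : Bool) : Arrow C ⥤ C where
  obj g := edgeObj g a
  map φ := edgeHom φ (le_refl a)
  map_id g := edgeHom_id_refl g a _
  map_comp φ ψ := (edgeHom_comp φ ψ _ _).symm

end Edge

/-! ### Tensor products of colimit cocones -/

section TensorColimit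

variable {C : Type u} [Category.{v} C] [MonoidalCategory C] {J : Type*} [Category J]

/-- The tensor product of a finite sequence of functors. -/
def tensorFunctor (n : ℕ) (F : Fin n → J ⥤ C) : J ⥤ C where
  obj j := tensorFin n fun i => (F i).obj j
  map φ := tensorFinMap n fun i => (F i).map φ
  map_id j := (congrArg _ (funext fun i => (F i).map_id j)).trans (tensorFinMap_id n _)
  map_comp φ ψ := (congrArg _ (funext fun i => (F i).map_comp φ ψ)).trans (tensorFinMap_comp n _ _)

/-- The tensor product of a finite sequence of cocones. -/
def tensorCocone (n : ℕ) {F : Fin n → J ⥤ C} (c : ∀ i, Cocone (F i)) :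
    Cocone (tensorFunctor n F) where
  pt := tensorFin n fun i => (c i).pt
  ι :=
    { app := fun j => tensorFinMap n fun i => (c i).ι.app j
      naturality := fun j j' φ => by
        refine (tensorFinMap_comp n _ _).symm.trans (Eq.trans ?_ (Category.comp_id _).symm)
        exact congrArg _ (funext fun i => (c i).w φ) }

variable [∀ X : C, PreservesFiniteColimits (tensorLeft X)]
  [∀ X : C, PreservesFiniteColimits (tensorRight X)]

/-- A tensor product of cocones is a colimit as soon as one of them is a colimit and the legs of the
others are isomorphisms. -/
theorem nonempty_isColimit_tensorCocone {J : Type} [SmallCategory J] [FinCategory J] :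
    ∀ (n : ℕ) (k : Fin n) {F : Fin n → J ⥤ C} (c : ∀ i, Cocone (F i)) (_ : IsColimit (c k))
      (_ : ∀ i, i ≠ k → ∀ j, IsIso ((c i).ι.app j)), Nonempty (IsColimit (tensorCocone n c))
  | n + 1, ⟨0, hk⟩, F, c, hc, h => by
    -- The tail has invertible legs, so the diagram is `F 0` tensored with a fixed object.
    have hiso : ∀ j, IsIso ((tensorCocone n fun i => c i.succ).ι.app j) := fun j =>
      tensorFinMap_isIso n _ fun i => h i.succ (Fin.succ_ne_zero i) j
    let α : tensorFunctor (n + 1) F ≅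
        F 0 ⋙ tensorRight (tensorCocone n fun i => c i.succ).pt :=
      NatIso.ofComponents (fun j => Iso.refl ((F 0).obj j) ⊗ᵢ
        @asIso _ _ _ _ _ (hiso j)) fun {j j'} φ => by
          have := (tensorCocone n fun i => c i.succ).w φ
          exact tensorHom_square ((Category.comp_id _).trans (Category.id_comp _).symm)
            (this.trans (Category.comp_id _).symm) |>.trans
              (congrArg (_ ≫ ·) (tensorHom_id _ _))
    refine ⟨IsColimit.ofIsoColimit ((IsColimit.precomposeHomEquiv α _).symm
      (isColimitOfPreserves (tensorRight (tensorCocone n fun i => c i.succ).pt) hc))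
      (Cocone.ext (Iso.refl _) fun j => ?_)⟩
    refine (Category.comp_id _).trans ?_
    refine (congrArg (_ ≫ ·) (tensorHom_id _ _).symm).trans ?_
    refine (tensorHom_comp_tensorHom _ _ _ _).trans ?_
    exact congrArg₂ (· ⊗ₘ ·) (Category.id_comp _) (Category.comp_id _)
  | n + 1, ⟨k + 1, hk⟩, F, c, hc, h => by
    obtain ⟨hc'⟩ := nonempty_isColimit_tensorCocone n ⟨k, by omega⟩ (fun i => c i.succ) hc
      fun i hi => h i.succ fun e => hi (Fin.succ_injective _ e)
    -- The head has invertible legs, so the diagram is a fixed object tensored with the tail.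
    have hiso : ∀ j, IsIso ((c 0).ι.app j) := h 0 (by simp [Fin.ext_iff])
    let α : tensorFunctor (n + 1) F ≅
        (tensorFunctor n fun i => F i.succ) ⋙ tensorLeft (c 0).pt :=
      NatIso.ofComponents (fun j => @asIso _ _ _ _ _ (hiso j) ⊗ᵢ Iso.refl _) fun {j j'} φ => by
          exact tensorHom_square (((c 0).w φ).trans (Category.comp_id _).symm)
            ((Category.comp_id _).trans (Category.id_comp _).symm) |>.trans
              (congrArg (_ ≫ ·) (id_tensorHom _ _))
    refine ⟨IsColimit.ofIsoColimit ((IsColimit.precomposeHomEquiv α _).symm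
      (isColimitOfPreserves (tensorLeft (c 0).pt) hc'))
      (Cocone.ext (Iso.refl _) fun j => ?_)⟩
    refine (Category.comp_id _).trans ?_
    refine (congrArg (_ ≫ ·) (id_tensorHom _ _).symm).trans ?_
    refine (tensorHom_comp_tensorHom _ _ _ _).trans ?_
    exact congrArg₂ (· ⊗ₘ ·) (Category.comp_id _) (Category.id_comp _)

end TensorColimit

/-! ### Iterated colimits over posets -/

section Colimits

variable {C : Type u} [Category.{v} C]

/-- If all legs of a cocone over a category with an initial object are isomorphisms, then the
cocone is a colimit. -/
theorem nonempty_isColimit_of_isIso {J : Type*} [Category J] {F : J ⥤ C} (c : Cocone F)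
    {j : J} (hj : IsInitial j) (h : ∀ j, IsIso (c.ι.app j)) : Nonempty (IsColimit c) :=
  ⟨{ desc := fun s => inv (c.ι.app j) ≫ s.ι.app j
     fac := fun s i => by
      have : IsIso (F.map (hj.to i)) := IsIso.of_isIso_fac_right (c.w (hj.to i))
      rw [← cancel_epi (F.map (hj.to i)), c.w_assoc, IsIso.hom_inv_id_assoc, s.w]
     uniq := fun s m hm => by rw [← hm j, IsIso.inv_hom_id_assoc] }⟩

/-- If `F : A × B → P` is a monotone map with a left adjoint `(l, r) : P → A × B`, and `D a` is the
colimit over `b` of `E (F a b)` naturally in `a`, then `D` and `E` have the same colimit: `F` is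
final, and the colimit over `A × B` is an iterated one. -/
theorem exists_colimit_iso_of_rows {A B P : Type*} [Preorder A] [Preorder B] [Preorder P]
    (D : A ⥤ C) (E : P ⥤ C) [HasColimit D] [HasColimit E] (F : A → B → P)
    (hF : ∀ {a a' b b'}, a ≤ a' → b ≤ b' → F a b ≤ F a' b')
    (l : P → A) (r : P → B) (hl : Monotone l) (hr : Monotone r)
    (unit : ∀ s, s ≤ F (l s) (r s)) (counit_left : ∀ a b, l (F a b) ≤ a)
    (counit_right : ∀ a b, r (F a b) ≤ b)
    (μ : ∀ a b, E.obj (F a b) ⟶ D.obj a)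
    (hμ : ∀ {a a' b b'} (ha : a ≤ a') (hb : b ≤ b'),
      E.map (homOfLE (hF ha hb)) ≫ μ a' b' = μ a b ≫ D.map (homOfLE ha))
    (hext : ∀ a {X : C} (f g : D.obj a ⟶ X), (∀ b, μ a b ≫ f = μ a b ≫ g) → f = g)
    (hdesc : ∀ a {X : C} (t : ∀ b, E.obj (F a b) ⟶ X),
      (∀ {b b'} (hb : b ≤ b'), E.map (homOfLE (hF le_rfl hb)) ≫ t b' = t b) →
        ∃ g : D.obj a ⟶ X, ∀ b, μ a b ≫ g = t b) :
    ∃ e : colimit D ≅ colimit E, ∀ a b,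
      μ a b ≫ colimit.ι D a ≫ e.hom = colimit.ι E (F a b) := by
  choose g hg using fun a => hdesc a (fun b => colimit.ι E (F a b)) fun _ => colimit.w E _
  -- In one direction, the row colimits map to `colimit E`; in the other, `E x` maps to the row `l x`.
  let p : colimit D ⟶ colimit E := colimit.desc D
    { pt := colimit E
      ι :=
        { app := g
          naturality := fun a a' φ => by
            refine Eq.trans (hext a _ _ fun b => ?_) (Category.comp_id _).symm
            have := hμ (leOfHom φ) (le_refl b)
            rw [hg, ← colimit.w E (homOfLE (hF (leOfHom φ) (le_refl b))), ← hg, reassoc_of% this]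
            rfl } }
  let q : colimit E ⟶ colimit D := colimit.desc E
    { pt := colimit D
      ι :=
        { app := fun x => E.map (homOfLE (unit x)) ≫ μ (l x) (r x) ≫ colimit.ι D (l x)
          naturality := fun x x' φ => by
            have hx := leOfHom φ
            have := hμ (hl hx) (hr hx)
            refine Eq.trans ?_ (Category.comp_id _).symm
            rw [← colimit.w D (homOfLE (hl hx)), ← reassoc_of% this, ← E.map_comp_assoc,
              ← E.map_comp_assoc]
            rfl } }
  have hp : ∀ a b, μ a b ≫ colimit.ι D a ≫ p = colimit.ι E (F a b) := fun a b => by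
    simp only [p, colimit.ι_desc, hg]
  have hq : ∀ x, colimit.ι E x ≫ q =
      E.map (homOfLE (unit x)) ≫ μ (l x) (r x) ≫ colimit.ι D (l x) := fun x => by
    simp only [q, colimit.ι_desc]
  refine ⟨⟨p, q, ?_, ?_⟩, hp⟩
  · refine colimit.hom_ext fun a => hext a _ _ fun b => ?_
    have := hμ (counit_left a b) (counit_right a b)
    rw [Category.comp_id, reassoc_of% hp a b, hq, ← colimit.w D (homOfLE (counit_left a b)),
      ← reassoc_of% this, ← E.map_comp_assoc]
    refine (congrArg (· ≫ _) (?_ : _ = 𝟙 _)).trans (Category.id_comp _)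
    exact E.map_id _
  · refine colimit.hom_ext fun x => ?_
    rw [Category.comp_id, reassoc_of% hq x, hp, colimit.w]

end Colimits

/-! ### Functoriality of polyhedral product maps -/

section Cubical

variable {C : Type u} [Category.{v} C] [MonoidalCategory C]

/-- The natural transformation of cubical functors induced by morphisms of arrows. -/
def cubicalHom {n : ℕ} {f g : Fin n → Arrow C} (φ : ∀ i, f i ⟶ g i) : cubical f ⟶ cubical g where
  app I := tensorFinMap n fun i => edgeHom (φ i) (le_refl (decide (i ∈ I)))
  naturality I J h := by
    refine tensorFinMap_square n fun i => ?_
    rw [← edgeHom_id, ← edgeHom_id, edgeHom_comp, edgeHom_comp, Category.id_comp, Category.comp_id]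

/-- The isomorphism of cubical functors induced by isomorphisms of arrows. -/
def cubicalIso {n : ℕ} {f g : Fin n → Arrow C} (e : ∀ i, f i ≅ g i) : cubical f ≅ cubical g :=
  NatIso.ofComponents (fun I => tensorFinIso n fun i => edgeIso (e i) (rfl : decide (i ∈ I) = _))
    fun {_ _} φ => (cubicalHom fun i => (e i).hom).naturality φ

/-- The tensor product of the `f_i`, for `i ∈ I`, and of the identities of `Y_i`, for `i ∉ I`: the
map of the cubical functor from the face `∅` to the face `I`. -/
def cubicalFrom {n : ℕ} (f : Fin n → Arrow C) (I : Finset (Fin n)) :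
    tensorFin n (fun i => (f i).left) ⟶ (cubical f).obj I :=
  tensorFinMap n (Z := fun i => edgeObj (f i) false) fun i =>
    edgeHom (𝟙 (f i)) (Bool.false_le (decide (i ∈ I)))

theorem cubicalFrom_map {n : ℕ} (f : Fin n → Arrow C) {I J : Finset (Fin n)} (h : I ⟶ J) :
    cubicalFrom f I ≫ (cubical f).map h = cubicalFrom f J := by
  refine (tensorFinMap_comp n _ _).symm.trans (congrArg _ (funext fun i => ?_))
  rw [← edgeHom_id, edgeHom_comp, Category.comp_id]

theorem cubicalEmptyIso_hom {n : ℕ} (K : SCpx n) (f : Fin n → Arrow C) :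
    (cubicalEmptyIso K f).hom = cubicalFrom f ∅ :=
  congrArg (tensorFinMap n) (funext fun i =>
    eqToHom_edgeObj (a := false) (b := decide (i ∈ (∅ : Finset (Fin n)))) (Eq.refl (f i))
      (by simp) (congrArg (edgeObj (f i)) (by simp)))

variable [HasFiniteColimits C]

/-- The polyhedral product map factors through every face of `K`. -/
theorem polyMap_hom_eq {n : ℕ} (K : SCpx n) (f : Fin n → Arrow C) (I : K.FaceCat) :
    (polyMap K f).hom = cubicalFrom f I.1 ≫ colimit.ι (K.incl ⋙ cubical f) I := by
  have h : (⟨∅, K.empty_mem⟩ : K.FaceCat) ≤ I := Finset.empty_subset I.1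
  refine (congrArg (· ≫ _) (cubicalEmptyIso_hom K f)).trans ?_
  refine (congrArg (_ ≫ ·) (colimit.w (K.incl ⋙ cubical f) (homOfLE h)).symm).trans ?_
  refine (Category.assoc _ _ _).symm.trans (congrArg (· ≫ _) ?_)
  exact cubicalFrom_map f (K.incl.map (homOfLE h))

/-- An isomorphism of polyhedral product maps is given by compatible isomorphisms of the sources
and of the colimits; the compatibility may be tested at any two faces. -/
noncomputable def polyMapIsoMk {n n' : ℕ} {K : SCpx n} {K' : SCpx n'} {f : Fin n → Arrow C}
    {f' : Fin n' → Arrow C}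
    (s : tensorFin n (fun i => (f i).left) ≅ tensorFin n' (fun i => (f' i).left))
    (t : colimit (K.incl ⋙ cubical f) ≅ colimit (K'.incl ⋙ cubical f'))
    (I : K.FaceCat) (I' : K'.FaceCat) (φ : (cubical f).obj I.1 ⟶ (cubical f').obj I'.1)
    (hs : cubicalFrom f I.1 ≫ φ = s.hom ≫ cubicalFrom f' I'.1)
    (ht : colimit.ι (K.incl ⋙ cubical f) I ≫ t.hom = φ ≫ colimit.ι (K'.incl ⋙ cubical f') I') :
    polyMap K f ≅ polyMap K' f' :=
  Arrow.isoMk s t (by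
    rw [polyMap_hom_eq K f I, polyMap_hom_eq K' f' I']
    refine (Category.assoc _ _ _).symm.trans (Eq.trans ?_ (Category.assoc _ _ _).symm)
    refine Eq.trans ?_ (congrArg (_ ≫ ·) ht.symm)
    exact (congrArg (· ≫ _) hs.symm).trans (Category.assoc _ _ _))

/-- Polyhedral product maps respect isomorphisms of arrows. -/
noncomputable def polyMapIso {n : ℕ} (K : SCpx n) {f g : Fin n → Arrow C} (e : ∀ i, f i ≅ g i) :
    polyMap K f ≅ polyMap K g :=
  polyMapIsoMk (tensorFinIso n fun i => Arrow.leftFunc.mapIso (e i))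
    (HasColimit.isoOfNatIso (Functor.isoWhiskerLeft K.incl (cubicalIso e)))
    ⟨∅, K.empty_mem⟩ ⟨∅, K.empty_mem⟩ ((cubicalIso e).hom.app ∅)
    (tensorFinMap_square n fun i => by
      have h := Bool.false_le (decide (i ∈ (∅ : Finset (Fin n))))
      refine (edgeHom_comp (𝟙 _) (e i).hom h (le_refl _)).trans
        (Eq.trans ?_ (edgeHom_comp (e i).hom (𝟙 _) (le_refl false) h).symm)
      rw [Category.id_comp, Category.comp_id])
    (HasColimit.isoOfNatIso_ι_hom _ _)

/-- The unit law: `{∅, {1}}` has a largest face, so that the colimit is `X ⊗ e`. -/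
theorem exists_polyMap_one_iso (f : Fin 1 → Arrow C) :
    ∃ e : polyMap SCpx.one f ≅ f 0, e.hom.left = (ρ_ (f 0).left).hom := by
  let T : SCpx.one.FaceCat := ⟨{0}, Or.inr rfl⟩
  have hT : IsTerminal T := by
    refine IsTerminal.ofUniqueHom (fun I => homOfLE ?_) fun _ _ => Subsingleton.elim _ _
    rintro x -
    exact Finset.mem_singleton.2 (Subsingleton.elim x 0)
  have := isIso_ι_of_isTerminal hT (SCpx.one.incl ⋙ cubical f)
  let t : (f 0).right ⊗ 𝟙_ C ≅ colimit (SCpx.one.incl ⋙ cubical f) :=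
    @asIso _ _ _ _ (colimit.ι (SCpx.one.incl ⋙ cubical f) T) this
  refine ⟨Arrow.isoMk (ρ_ (f 0).left) (t.symm ≪≫ ρ_ _) ?_, rfl⟩
  rw [polyMap_hom_eq SCpx.one f T]
  have e : edgeHom (𝟙 (f 0)) (Bool.false_le true) = (f 0).hom := Category.comp_id _
  have key : ∀ g : (f 0).left ⟶ (f 0).right, g = (f 0).hom → (ρ_ (f 0).left).hom ≫ (f 0).hom =
      ((g ⊗ₘ 𝟙 (𝟙_ C)) ≫ t.hom) ≫ t.inv ≫ (ρ_ _).hom := by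
    rintro _ rfl
    rw [Category.assoc, Iso.hom_inv_id_assoc, tensorHom_id, rightUnitor_naturality]
  exact key _ e

end Cubical

/-! ### Equivariance -/

section Permutation

variable {C : Type u} [Category.{v} C] [MonoidalCategory C] [SymmetricCategory C]

/-- The faces of `K · σ` correspond to those of `K` under `S ↦ σ(S)`. -/
def SCpx.permFaces {n : ℕ} (K : SCpx n) (σ : Equiv.Perm (Fin n)) :
    (K.perm σ).FaceCat ≃o K.FaceCat where
  toFun S := ⟨S.1.map σ.toEmbedding, S.2⟩
  invFun I := ⟨I.1.map σ.symm.toEmbedding, by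
    change (I.1.map σ.symm.toEmbedding).map σ.toEmbedding ∈ K.faces
    rw [map_map_symm]
    exact I.2⟩
  left_inv S := Subtype.ext (map_map_symm σ.symm S.1)
  right_inv I := Subtype.ext (map_map_symm σ I.1)
  map_rel_iff' {S T} := Finset.map_subset_map (f := σ.toEmbedding) (s₁ := S.1) (s₂ := T.1)

/-- The cubical functors of `f ∘ σ` and of `f` agree along `S ↦ σ(S)`, up to the symmetry. -/
def cubicalPermIso {n : ℕ} (f : Fin n → Arrow C) (σ : Equiv.Perm (Fin n)) (S : Finset (Fin n)) :
    (cubical (f ∘ σ)).obj S ≅ (cubical f).obj (S.map σ.toEmbedding) :=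
  tensorFinIso n (fun i => edgeIso (Iso.refl (f (σ i)))
    (decide_eq_decide.2 (mem_map_perm σ S i).symm)) ≪≫
  permIso n σ fun i => edgeObj (f i) (decide (i ∈ S.map σ.toEmbedding))

theorem cubicalPermIso_naturality {n : ℕ} (f : Fin n → Arrow C) (σ : Equiv.Perm (Fin n))
    {S T : Finset (Fin n)} (h : S ⟶ T) (h' : S.map σ.toEmbedding ⟶ T.map σ.toEmbedding) :
    (cubical (f ∘ σ)).map h ≫ (cubicalPermIso f σ T).hom =
      (cubicalPermIso f σ S).hom ≫ (cubical f).map h' := by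
  refine Eq.trans ?_ (Category.assoc _ _ _).symm
  refine Eq.trans ?_ (congrArg (_ ≫ ·) (permIso_naturality n σ fun i =>
    edgeMap (f i) (decide_mem_le (leOfHom h') i)))
  refine (Category.assoc _ _ _).symm.trans (Eq.trans ?_ (Category.assoc _ _ _))
  refine congrArg (· ≫ _) (tensorFinMap_square n fun i => ?_)
  rw [← edgeHom_id, ← edgeHom_id]
  exact (edgeHom_comp _ _ _ _).trans (edgeHom_comp _ _ _ _).symm

theorem cubicalFrom_cubicalPermIso {n : ℕ} (f : Fin n → Arrow C) (σ : Equiv.Perm (Fin n))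
    (S : Finset (Fin n)) :
    cubicalFrom (f ∘ σ) S ≫ (cubicalPermIso f σ S).hom =
      (permIso n σ fun i => (f i).left).hom ≫ cubicalFrom f (S.map σ.toEmbedding) := by
  refine Eq.trans ?_ (permIso_naturality n σ (Z := fun i => edgeObj (f i) false) fun i =>
    edgeHom (𝟙 (f i)) (Bool.false_le (decide (i ∈ S.map σ.toEmbedding))))
  refine (Category.assoc _ _ _).symm.trans (congrArg (· ≫ _) ?_)
  refine (tensorFinMap_comp n _ _).symm.trans (congrArg _ (funext fun i => ?_))
  exact (edgeHom_comp _ _ _ _).trans (congrArg (edgeHom · _) (Category.id_comp _))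

/-- Equivariance of the polyhedral product maps. -/
theorem exists_polyMap_perm_iso [HasFiniteColimits C] {n : ℕ} (K : SCpx n)
    (σ : Equiv.Perm (Fin n)) (f : Fin n → Arrow C) :
    ∃ e : polyMap (K.perm σ) (f ∘ σ) ≅ polyMap K f,
      e.hom.left = (permIso n σ fun i => (f i).left).hom := by
  let w : (K.perm σ).incl ⋙ cubical (f ∘ σ) ≅
      (K.permFaces σ).equivalence.functor ⋙ K.incl ⋙ cubical f :=
    NatIso.ofComponents (fun S => cubicalPermIso f σ S.1) fun {S T} φ =>
      cubicalPermIso_naturality f σ ((K.perm σ).incl.map φ)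
        (K.incl.map ((K.permFaces σ).equivalence.functor.map φ))
  let t := HasColimit.isoOfNatIso w ≪≫
    Functor.Final.colimitIso (K.permFaces σ).equivalence.functor (K.incl ⋙ cubical f)
  have ht : ∀ S, colimit.ι _ S ≫ t.hom =
      (cubicalPermIso f σ S.1).hom ≫ colimit.ι (K.incl ⋙ cubical f) (K.permFaces σ S) := by
    intro S
    rw [Iso.trans_hom, HasColimit.isoOfNatIso_ι_hom_assoc, Functor.Final.ι_colimitIso_hom]
    rfl
  exact ⟨polyMapIsoMk (permIso n σ fun i => (f i).left) t ⟨∅, (K.perm σ).empty_mem⟩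
    (K.permFaces σ ⟨∅, (K.perm σ).empty_mem⟩) (cubicalPermIso f σ ∅).hom
    (cubicalFrom_cubicalPermIso f σ ∅) (ht _), rfl⟩

end Permutation

/-! ### Isomorphism classes of arrows -/

section Classes

variable {C : Type u} [Category.{v} C]

theorem graft_comp {α β : Type*} {n m p : ℕ} (h : p + 1 = n + m) (k : Fin n) (F : α → β) (y : α)
    (x : Fin p → α) : graft h k (F y) (fun i => F (x i)) = fun i => F (graft h k y x i) := by
  funext i
  unfold graft
  split_ifs <;> rfl

theorem exists_mk_eq {n : ℕ} (x : Fin n → Quotient (isIsomorphicSetoid (Arrow C))) :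
    ∃ f : Fin n → Arrow C, x = fun i => Quotient.mk _ (f i) :=
  ⟨fun i => (x i).out, funext fun i => (Quotient.out_eq (x i)).symm⟩

variable [MonoidalCategory C] [HasFiniteColimits C]

/-- The operation of `K` on isomorphism classes of arrows, computed on chosen representatives. -/
noncomputable def polyClass {n : ℕ} (K : SCpx n)
    (x : Fin n → Quotient (isIsomorphicSetoid (Arrow C))) :
    Quotient (isIsomorphicSetoid (Arrow C)) :=
  Quotient.mk _ (polyMap K fun i => (x i).out)

theorem polyClass_mk {n : ℕ} (K : SCpx n) (f : Fin n → Arrow C) :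
    polyClass K (fun i => Quotient.mk _ (f i)) = Quotient.mk _ (polyMap K f) :=
  Quotient.sound ⟨polyMapIso K fun i =>
    (Quotient.exact (Quotient.out_eq (Quotient.mk (isIsomorphicSetoid (Arrow C)) (f i)))).some⟩

/-- The algebra structure on isomorphism classes of arrows, given the compatibility of the
polyhedral product maps with substitution. -/
noncomputable def polyAlgebra [SymmetricCategory C]
    (hcomp : ∀ {n m p : ℕ} (h : p + 1 = n + m) (k : Fin n) (K : SCpx n) (L : SCpx m)
      (f : Fin p → Arrow C), Nonempty (polyMap K (graft h k (polyMap L (f ∘ innerIdx h k)) f) ≅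
        polyMap (K.subst h k L) f)) :
    substOperad.Algebra (Quotient (isIsomorphicSetoid (Arrow C))) where
  act {n} := polyClass (n := n)
  act_perm {n} K σ x := by
    obtain ⟨f, rfl⟩ := exists_mk_eq x
    refine (polyClass_mk (SCpx.perm K σ) (f ∘ σ)).trans (Eq.trans ?_ (polyClass_mk K f).symm)
    exact Quotient.sound ⟨(exists_polyMap_perm_iso K σ f).choose⟩
  act_one x := by
    obtain ⟨f, rfl⟩ := exists_mk_eq x
    refine (polyClass_mk SCpx.one f).trans ?_
    exact Quotient.sound ⟨(exists_polyMap_one_iso f).choose⟩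
  act_comp {n m p} h k K L x := by
    obtain ⟨f, rfl⟩ := exists_mk_eq x
    refine (polyClass_mk (SCpx.subst h k K L) f).trans ?_
    refine (Quotient.sound (hcomp h k K L f)).symm.trans ?_
    refine (polyClass_mk K _).symm.trans (congrArg (polyClass K) ?_)
    refine (graft_comp h k _ _ f).symm.trans (congrArg (graft h k · _) ?_)
    exact (polyClass_mk L (f ∘ innerIdx h k)).symm

end Classes

/-! ### Substitution of faces and its left adjoint -/

section Faces

variable {n m p : ℕ} (h : p + 1 = n + m) (k : Fin n)

theorem substFace_mono {I I' : Finset (Fin n)} {J J' : Finset (Fin m)} (hI : I ⊆ I')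
    (hJ : J ⊆ J') : substFace h k I J ⊆ substFace h k I' J' := by
  intro x hx
  rcases slot_cases h k x with ⟨i, rfl⟩ | ⟨j, rfl⟩
  · rw [outerIdx_mem] at hx ⊢
    exact hI hx
  · rw [innerIdx_mem] at hx ⊢
    exact ⟨hI hx.1, hJ hx.2⟩

theorem decide_innerIdx_mem (I : Finset (Fin n)) (J : Finset (Fin m)) (j : Fin m) :
    (decide (k ∈ I) && decide (j ∈ J)) = decide (innerIdx h k j ∈ substFace h k I J) := by
  simp [innerIdx_mem]

theorem decide_outerIdx_mem (I : Finset (Fin n)) (J : Finset (Fin m)) (i : {i : Fin n // i ≠ k}) :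
    decide (i.1 ∈ I) = decide (outerIdx h k i ∈ substFace h k I J) := by
  simp [outerIdx_mem]

open Classical in
/-- The smallest `I ⊆ [n]` such that `S ⊆ I ∘_k J` for some `J ⊆ [m]`. -/
noncomputable def outerPart (S : Finset (Fin p)) : Finset (Fin n) :=
  {i | (i = k ∧ ∃ j, innerIdx h k j ∈ S) ∨ ∃ hi : i ≠ k, outerIdx h k ⟨i, hi⟩ ∈ S}

/-- The part of `S ⊆ [n + m - 1]` in the inserted block `[m]`. -/
def innerPart (S : Finset (Fin p)) : Finset (Fin m) := {j | innerIdx h k j ∈ S}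

/-- The left adjoint of substitution of subsets. -/
theorem subset_substFace_iff (S : Finset (Fin p)) (I : Finset (Fin n)) (J : Finset (Fin m)) :
    S ⊆ substFace h k I J ↔ outerPart h k S ⊆ I ∧ innerPart h k S ⊆ J := by
  constructor
  · intro hS
    constructor
    · intro i hi
      rw [outerPart, Finset.mem_filter] at hi
      rcases hi.2 with ⟨rfl, j, hj⟩ | ⟨hik, hi⟩
      · exact ((innerIdx_mem h _ I J j).1 (hS hj)).1
      · exact (outerIdx_mem h k I J ⟨i, hik⟩).1 (hS hi)
    · intro j hj
      rw [innerPart, Finset.mem_filter] at hj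
      exact ((innerIdx_mem h _ I J j).1 (hS hj.2)).2
  · rintro ⟨hI, hJ⟩ x hx
    rcases slot_cases h k x with ⟨i, rfl⟩ | ⟨j, rfl⟩
    · rw [outerIdx_mem]
      exact hI (Finset.mem_filter.2 ⟨Finset.mem_univ _, Or.inr ⟨i.2, hx⟩⟩)
    · rw [innerIdx_mem]
      exact ⟨hI (Finset.mem_filter.2 ⟨Finset.mem_univ _, Or.inl ⟨rfl, j, hx⟩⟩),
        hJ (Finset.mem_filter.2 ⟨Finset.mem_univ _, hx⟩)⟩

end Faces

/-! ### A polyhedral product map as a colimit of arrows -/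

section Block

variable {C : Type u} [Category.{v} C] [MonoidalCategory C]

/-- The arrow `Y_1 ⊗ ⋯ ⊗ Y_m ⟶ z_m(J)`, as a functor of `J`. -/
def blockArrow {m : ℕ} (g : Fin m → Arrow C) : Finset (Fin m) ⥤ Arrow C where
  obj J := Arrow.mk (cubicalFrom g J)
  map φ := Arrow.homMk (𝟙 _) ((cubical g).map φ)
    ((Category.id_comp _).trans (cubicalFrom_map g φ).symm)
  map_id J := Arrow.hom_ext _ _ rfl ((cubical g).map_id J)
  map_comp φ ψ := Arrow.hom_ext _ _ (Category.comp_id _).symm ((cubical g).map_comp φ ψ)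

/-- The evaluation of the arrow `Y_1 ⊗ ⋯ ⊗ Y_m ⟶ z_m(J)` at a truth value `a` is the tensor product
of the `X_j`, if `a` holds and `j ∈ J`, and of the `Y_j` otherwise. -/
def blockEdgeIso {m : ℕ} (g : Fin m → Arrow C) (J : Finset (Fin m)) : ∀ (a : Bool) (b : Fin m → Bool)
    (_ : ∀ j, (a && decide (j ∈ J)) = b j),
    edgeObj ((blockArrow g).obj J) a ≅ tensorFin m fun j => edgeObj (g j) (b j)
  | true, _, h => tensorFinIso m fun j => edgeIso (Iso.refl (g j)) (h j)
  | false, _, h => tensorFinIso m fun j => edgeIso (a := false) (Iso.refl (g j)) (h j)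

theorem blockEdgeIso_naturality {m : ℕ} (g : Fin m → Arrow C) {J J' : Finset (Fin m)} (φ : J ⟶ J') :
    ∀ {a a' : Bool} (ha : a ≤ a') {b b' : Fin m → Bool} (h : ∀ j, (a && decide (j ∈ J)) = b j)
      (h' : ∀ j, (a' && decide (j ∈ J')) = b' j) (hb : ∀ j, b j ≤ b' j),
    edgeHom ((blockArrow g).map φ) ha ≫ (blockEdgeIso g J' a' b' h').hom =
      (blockEdgeIso g J a b h).hom ≫ tensorFinMap m fun j => edgeMap (g j) (hb j)
  | true, true, _, b, b', h, h', hb => by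
    refine tensorFinMap_square m fun j => ?_
    rw [← edgeHom_id, ← edgeHom_id]
    exact (edgeHom_comp _ _ _ _).trans (edgeHom_comp _ _ _ _).symm
  | false, true, _, b, b', h, h', hb => by
    have e : edgeHom ((blockArrow g).map φ) (Bool.false_le true) = cubicalFrom g J' :=
      cubicalFrom_map g φ
    refine (congrArg (· ≫ _) e).trans (tensorFinMap_square m fun j => ?_)
    rw [← edgeHom_id]
    exact (edgeHom_comp _ _ _ _).trans (edgeHom_comp _ _ _ _).symm
  | false, false, _, b, b', h, h', hb => by
    refine (Category.id_comp _).trans ?_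
    refine (congrArg (tensorFinMap m) (funext fun j => ?_)).trans (tensorFinMap_comp m _ _)
    rw [← edgeHom_id]
    exact (congrArg (edgeHom · _) (Category.comp_id _)).symm.trans (edgeHom_comp _ _ _ _).symm
  | true, false, ha, _, _, _, _, _ => absurd ha (by decide)

variable [HasFiniteColimits C]

/-- The polyhedral product map of `L`, as the colimit of the arrows `Y_1 ⊗ ⋯ ⊗ Y_m ⟶ z_m(J)` over the
faces `J` of `L`. -/
noncomputable def blockCocone {m : ℕ} (L : SCpx m) (g : Fin m → Arrow C) :
    Cocone (L.incl ⋙ blockArrow g) where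
  pt := polyMap L g
  ι :=
    { app := fun J => Arrow.homMk (𝟙 _) (colimit.ι (L.incl ⋙ cubical g) J)
        ((Category.id_comp _).trans (polyMap_hom_eq L g J))
      naturality := fun _ _ φ => Arrow.hom_ext _ _ rfl
        ((colimit.w (L.incl ⋙ cubical g) φ).trans (Category.comp_id _).symm) }

/-- At sources all legs are identities and the face poset has the least element `∅`; at targets this
is the defining colimit. -/
theorem nonempty_isColimit_blockCocone {m : ℕ} (L : SCpx m) (g : Fin m → Arrow C) : ∀ a : Bool,
    Nonempty (IsColimit ((edgeFunctor C a).mapCocone (blockCocone L g)))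
  | true => ⟨colimit.isColimit (L.incl ⋙ cubical g)⟩
  | false =>
    have h : IsInitial (⟨∅, L.empty_mem⟩ : L.FaceCat) :=
      IsInitial.ofUniqueHom (fun J => homOfLE (Finset.empty_subset J.1))
        fun _ _ => Subsingleton.elim _ _
    nonempty_isColimit_of_isIso _ h fun _ =>
      inferInstanceAs (IsIso (𝟙 (tensorFin m fun j => (g j).left)))

end Block

/-! ### Grafted sequences -/

section Graft

theorem graft_of_eq {α : Type*} {n m p : ℕ} (h : p + 1 = n + m) {k i : Fin n} (hi : i = k) (y : α)
    (x : Fin p → α) : graft h k y x i = y := dif_pos hi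

theorem graft_of_ne {α : Type*} {n m p : ℕ} (h : p + 1 = n + m) {k i : Fin n} (hi : i ≠ k) (y : α)
    (x : Fin p → α) : graft h k y x i = x (outerIdx h k ⟨i, hi⟩) := dif_neg hi

variable {D : Type u} [Category.{v} D] {n m p : ℕ} (h : p + 1 = n + m) (k : Fin n)

/-- The `i`-th term of the sequence `(x_1, …, x_{k-1}, y, x_{k+m}, …)`, as a functor of `y`. -/
def graftFunctor (x : Fin p → D) (i : Fin n) : D ⥤ D where
  obj y := graft h k y x i
  map {y y'} φ :=
    if hi : i = k then eqToHom (graft_of_eq h hi y x) ≫ φ ≫ eqToHom (graft_of_eq h hi y' x).symm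
    else eqToHom ((graft_of_ne h hi y x).trans (graft_of_ne h hi y' x).symm)
  map_id y := by split_ifs <;> simp
  map_comp φ ψ := by split_ifs <;> simp

theorem graftFunctor_map_self (x : Fin p → D) {y y' : D} (φ : y ⟶ y') :
    (graftFunctor h k x k).map φ ≫ eqToHom (graft_of_eq h rfl y' x) =
      eqToHom (graft_of_eq h rfl y x) ≫ φ := by
  simp only [graftFunctor, dite_true, Category.assoc]
  simp

theorem graftFunctor_map_of_ne (x : Fin p → D) {i : Fin n} (hi : i ≠ k) {y y' : D} (φ : y ⟶ y') :
    (graftFunctor h k x i).map φ ≫ eqToHom (graft_of_ne h hi y' x) =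
      eqToHom (graft_of_ne h hi y x) := by
  simp only [graftFunctor, hi, dite_false]
  simp

/-- The `k`-th term of `(x_1, …, x_{k-1}, y, x_{k+m}, …)` is `y`. -/
def graftFunctorSelf (x : Fin p → D) : graftFunctor h k x k ≅ 𝟭 D :=
  NatIso.ofComponents (fun y => eqToIso (graft_of_eq h rfl y x)) fun φ =>
    graftFunctor_map_self h k x φ

theorem isIso_graftFunctor_map (x : Fin p → D) {i : Fin n} (hi : i ≠ k) {y y' : D} (φ : y ⟶ y') :
    IsIso ((graftFunctor h k x i).map φ) := by
  simp only [graftFunctor, hi, dite_false]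
  infer_instance

end Graft

/-! ### Pasting of squares -/

section Squares

variable {C : Type u} [Category.{v} C]

theorem comp_square {X X' Y Y' Z Z' : C} {x : X ⟶ X'} {y : Y ⟶ Y'} {z : Z ⟶ Z'} {e : X ⟶ Y}
    {e' : X' ⟶ Y'} {g : Y ⟶ Z} {g' : Y' ⟶ Z'} (h : x ≫ e' = e ≫ y) (h' : y ≫ g' = g ≫ z) :
    x ≫ e' ≫ g' = (e ≫ g) ≫ z := by
  rw [reassoc_of% h, h', Category.assoc]

theorem inv_square {X X' Y Y' Z Z' : C} {e : X ≅ Y} {e' : X' ≅ Y'} {x : X ⟶ X'} {y : Y ⟶ Y'}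
    {g : X ⟶ Z} {g' : X' ⟶ Z'} {z : Z ⟶ Z'} (h : x ≫ e'.hom = e.hom ≫ y) (h' : x ≫ g' = g ≫ z) :
    y ≫ e'.inv ≫ g' = (e.inv ≫ g) ≫ z := by
  rw [Category.assoc, ← h', ← cancel_epi e.hom, ← reassoc_of% h, Iso.hom_inv_id_assoc,
    Iso.hom_inv_id_assoc]

theorem inv_comp_eq_of_squares {X X' Y Y' V W : C} {e : X ≅ Y} {e' : X' ≅ Y'} {x : X ⟶ X'}
    {y : Y ⟶ Y'} {g : X ⟶ V} {g' : X' ⟶ W} {z : V ⟶ W} {s : V ≅ Y} (h : x ≫ e'.hom = e.hom ≫ y)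
    (h' : x ≫ g' = g ≫ z) (hs : g ≫ s.hom = e.hom) :
    y ≫ e'.inv ≫ g' = s.inv ≫ z := by
  rw [inv_square h h', ← cancel_epi e.hom, Category.assoc, Iso.hom_inv_id_assoc, ← hs,
    Category.assoc, Iso.hom_inv_id_assoc]

theorem edgeHom_square {g₁ g₂ g₃ g₄ : Arrow C} {φ : g₁ ⟶ g₂} {φ' : g₃ ⟶ g₄} {ψ : g₁ ⟶ g₃}
    {ψ' : g₂ ⟶ g₄} {a b c d : Bool} (h : φ ≫ ψ' = ψ ≫ φ') (hab : a ≤ b) (hbd : b ≤ d) (hac : a ≤ c)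
    (hcd : c ≤ d) : edgeHom φ hab ≫ edgeHom ψ' hbd = edgeHom ψ hac ≫ edgeHom φ' hcd := by
  rw [edgeHom_comp, edgeHom_comp, h]

end Squares

/-! ### Compatibility with substitution -/

section Substitution

variable {C : Type u} [Category.{v} C] [MonoidalCategory C] {n m p : ℕ} (h : p + 1 = n + m)
  (k : Fin n) (f : Fin p → Arrow C)

/-- The sequence `(f_1, …, f_{k-1}, Y_k ⊗ ⋯ ⟶ z_m(J), f_{k+m}, …)`, as a functor of `J`. -/
def blockSeq (i : Fin n) : Finset (Fin m) ⥤ Arrow C :=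
  blockArrow (f ∘ innerIdx h k) ⋙ graftFunctor h k f i

/-- The associativity isomorphism `⨂ i, edgeObj (g i) (a i) ≅ ⨂ x, edgeObj (f x) (b x)`, where `g` is
the grafted sequence `blockSeq` at `J`, for truth values `a` and `b` which correspond to each other
under substitution. -/
noncomputable def blockSeqIso (J : Finset (Fin m)) (a : Fin n → Bool) (b : Fin p → Bool)
    (hk : ∀ j, (a k && decide (j ∈ J)) = b (innerIdx h k j))
    (ho : ∀ i : {i : Fin n // i ≠ k}, a i = b (outerIdx h k i)) :
    tensorFin n (fun i => edgeObj ((blockSeq h k f i).obj J) (a i)) ≅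
      tensorFin p fun x => edgeObj (f x) (b x) :=
  insertIso n m p h k (fun i => edgeObj ((blockSeq h k f i).obj J) (a i))
    (fun x => edgeObj (f x) (b x))
    (edgeIso (eqToIso (graft_of_eq h rfl _ f)) rfl ≪≫
      blockEdgeIso (f ∘ innerIdx h k) J (a k) (fun j => b (innerIdx h k j)) hk)
    (fun i => edgeIso (eqToIso (graft_of_ne h i.2 _ f)) (ho i))

theorem blockSeqIso_naturality {J J' : Finset (Fin m)} (ψ : J ⟶ J') {a a' : Fin n → Bool}
    {b b' : Fin p → Bool} (hk : ∀ j, (a k && decide (j ∈ J)) = b (innerIdx h k j))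
    (ho : ∀ i : {i : Fin n // i ≠ k}, a i = b (outerIdx h k i))
    (hk' : ∀ j, (a' k && decide (j ∈ J')) = b' (innerIdx h k j))
    (ho' : ∀ i : {i : Fin n // i ≠ k}, a' i = b' (outerIdx h k i))
    (ha : ∀ i, a i ≤ a' i) (hb : ∀ x, b x ≤ b' x) :
    tensorFinMap n (fun i => edgeHom ((blockSeq h k f i).map ψ) (ha i)) ≫
        (blockSeqIso h k f J' a' b' hk' ho').hom =
      (blockSeqIso h k f J a b hk ho).hom ≫ tensorFinMap p fun x => edgeMap (f x) (hb x) := by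
  refine insertIso_naturality n m p h k _ _ _ _ _ _ ?_ fun i => ?_
  · exact comp_square (edgeHom_square (graftFunctor_map_self h k f _) _ _ _ (ha k))
      (blockEdgeIso_naturality (f ∘ innerIdx h k) ψ (ha k) hk hk' fun j => hb (innerIdx h k j))
  · rw [← edgeHom_id]
    exact edgeHom_square ((graftFunctor_map_of_ne h k f i.2 _).trans (Category.comp_id _).symm)
      (ha i) _ _ (hb (outerIdx h k i))

/-- The isomorphism between the values of the cubical functors of the grafted sequence and of `f` at
`I` and `I ∘_k J`. -/
noncomputable def substIso (I : Finset (Fin n)) (J : Finset (Fin m)) :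
    (cubical fun i => (blockSeq h k f i).obj J).obj I ≅ (cubical f).obj (substFace h k I J) :=
  blockSeqIso h k f J (fun i => decide (i ∈ I)) (fun x => decide (x ∈ substFace h k I J))
    (decide_innerIdx_mem h k I J) (decide_outerIdx_mem h k I J)

/-- The isomorphism between the sources of the grafted sequence of arrows and of `f`. -/
noncomputable def blockSourceIso (J : Finset (Fin m)) :
    tensorFin n (fun i => ((blockSeq h k f i).obj J).left) ≅ tensorFin p fun x => (f x).left :=
  blockSeqIso h k f J (fun _ => false) (fun _ => false) (fun _ => rfl) (fun _ => rfl)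

theorem cubicalFrom_substIso (I : Finset (Fin n)) (J : Finset (Fin m)) :
    cubicalFrom (fun i => (blockSeq h k f i).obj J) I ≫ (substIso h k f I J).hom =
      (blockSourceIso h k f J).hom ≫ cubicalFrom f (substFace h k I J) := by
  have := blockSeqIso_naturality h k f (𝟙 J) (a := fun _ => false) (b := fun _ => false)
    (a' := fun i => decide (i ∈ I)) (b' := fun x => decide (x ∈ substFace h k I J))
    (fun _ => rfl) (fun _ => rfl) (decide_innerIdx_mem h k I J) (decide_outerIdx_mem h k I J)
    (fun _ => Bool.false_le _) (fun _ => Bool.false_le _)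
  refine Eq.trans (congrArg (fun t => tensorFinMap n t ≫ _) (funext fun i => ?_)) (this.trans ?_)
  · exact congrArg (edgeHom · _) ((blockSeq h k f i).map_id J).symm
  · exact congrArg (fun t => _ ≫ tensorFinMap p t) (funext fun x => (edgeHom_id _ _).symm)

variable [HasFiniteColimits C] (L : SCpx m)

/-- The sequence `(f_1, …, f_{k-1}, g, f_{k+m}, …)`, where `g` is the polyhedral product map of
`L`. -/
noncomputable abbrev polySeq : Fin n → Arrow C := graft h k (polyMap L (f ∘ innerIdx h k)) f

/-- The morphism from the `i`-th term of `blockSeq` at the face `J` of `L` to that of `polySeq`. -/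
noncomputable def graftLeg (J : L.FaceCat) (i : Fin n) :
    (blockSeq h k f i).obj J.1 ⟶ polySeq h k f L i :=
  (graftFunctor h k f i).map ((blockCocone L (f ∘ innerIdx h k)).ι.app J)

theorem blockSeq_map_graftLeg {J J' : L.FaceCat} (ψ : J ⟶ J') (i : Fin n) :
    (blockSeq h k f i).map (L.incl.map ψ) ≫ graftLeg h k f L J' i = graftLeg h k f L J i :=
  ((graftFunctor h k f i).map_comp _ _).symm.trans
    (congrArg _ ((blockCocone L (f ∘ innerIdx h k)).w ψ))

/-- The morphism `z(I ∘_k J) ⟶ z(I)` from the cubical functor of `f` to that of `polySeq`. -/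
noncomputable def rowLeg (I : Finset (Fin n)) (J : L.FaceCat) :
    (cubical f).obj (substFace h k I J.1) ⟶ (cubical (polySeq h k f L)).obj I :=
  (substIso h k f I J.1).inv ≫ (cubicalHom (graftLeg h k f L J)).app I

theorem rowLeg_naturality {I I' : Finset (Fin n)} {J J' : L.FaceCat} (φ : I ⟶ I') (ψ : J ⟶ J')
    (χ : substFace h k I J.1 ⟶ substFace h k I' J'.1) :
    (cubical f).map χ ≫ rowLeg h k f L I' J' =
      rowLeg h k f L I J ≫ (cubical (polySeq h k f L)).map φ := by
  have hI := fun i => decide_mem_le (leOfHom φ) i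
  refine inv_square (blockSeqIso_naturality h k f (L.incl.map ψ) _ _ _ _ hI
    (fun x => decide_mem_le (leOfHom χ) x)) (tensorFinMap_square n fun i => ?_)
  rw [← edgeHom_id]
  exact edgeHom_square ((blockSeq_map_graftLeg h k f L ψ i).trans (Category.comp_id _).symm)
    (hI i) _ _ (hI i)

/-- On sources, the grafted legs are identities up to the associativity isomorphisms. -/
theorem graftLeg_sourceIso (K : SCpx n) (J : L.FaceCat) :
    tensorFinMap n (fun i => (graftLeg h k f L J i).left) ≫ (sourceIso h k K L f).hom =
      (blockSourceIso h k f J.1).hom := by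
  refine (insertIso_naturality n m p h k (W := fun i => edgeObj ((blockSeq h k f i).obj J.1) false)
    (W' := fun i => edgeObj (polySeq h k f L i) false)
    (Z := fun x => edgeObj (f x) false) (Z' := fun x => edgeObj (f x) false)
    _ _ _ _ (fun i => edgeHom (graftLeg h k f L J i) (le_refl false))
    (fun x => 𝟙 _) ?_ fun i => ?_).trans
    ((congrArg (_ ≫ ·) (tensorFinMap_id p _)).trans (Category.comp_id _))
  · have e : polySeq h k f L k = polyMap L (f ∘ innerIdx h k) := graft_of_eq h rfl _ f
    have w : edgeObj (polySeq h k f L k) false = edgeObj (polyMap L (f ∘ innerIdx h k)) false := by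
      rw [e]
    have e₁ : (blockEdgeIso (f ∘ innerIdx h k) J.1 false (fun _ => false) fun _ => rfl).hom =
        edgeHom ((blockCocone L (f ∘ innerIdx h k)).ι.app J) (le_refl false) :=
      tensorFinMap_id m _
    refine (congrArg (_ ≫ ·) (eqToHom_edgeObj e (rfl : false = false) w)).trans ?_
    refine (edgeHom_square (graftFunctor_map_self h k f _) (le_refl false) (le_refl false)
      (le_refl false) (le_refl false)).trans ?_
    refine Eq.trans ?_ ((congrArg (_ ≫ ·) (tensorFinMap_id m _)).trans (Category.comp_id _)).symm
    exact congrArg (_ ≫ ·) e₁.symm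
  · have e : polySeq h k f L i = f (outerIdx h k i) := graft_of_ne h i.2 _ f
    have w : edgeObj (polySeq h k f L i) false = edgeObj (f (outerIdx h k i)) false := by rw [e]
    refine (congrArg (_ ≫ ·) (eqToHom_edgeObj e (rfl : false = false) w)).trans ?_
    refine (edgeHom_comp _ _ _ _).trans (Eq.trans ?_ (Category.comp_id _).symm)
    exact congrArg (edgeHom · _) (graftFunctor_map_of_ne h k f i.2 _)

/-- On sources, the morphisms `z(I ∘_k J) ⟶ z(I)` are the inverse of the associativity isomorphism. -/
theorem cubicalFrom_rowLeg (K : SCpx n) (I : Finset (Fin n)) (J : L.FaceCat) :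
    cubicalFrom f (substFace h k I J.1) ≫ rowLeg h k f L I J =
      (sourceIso h k K L f).inv ≫ cubicalFrom (polySeq h k f L) I :=
  inv_comp_eq_of_squares (cubicalFrom_substIso h k f I J.1)
    (tensorFinMap_square n fun i => edgeHom_square (φ' := 𝟙 (polySeq h k f L i))
      ((Category.id_comp _).trans (Category.comp_id _).symm) _ _ (le_refl false) _)
    (graftLeg_sourceIso h k f L K J)

variable [∀ X : C, PreservesFiniteColimits (tensorLeft X)]
  [∀ X : C, PreservesFiniteColimits (tensorRight X)]

/-- For a fixed face `I`, the object `z(I)` of the grafted sequence is the colimit over the faces of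
`L`: its `k`-th factor is one, and the other factors do not depend on `J`. -/
theorem nonempty_isColimit_graftLeg (I : Finset (Fin n)) :
    Nonempty (IsColimit (tensorCocone n fun i =>
      (graftFunctor h k f i ⋙ edgeFunctor C (decide (i ∈ I))).mapCocone
        (blockCocone L (f ∘ innerIdx h k)))) := by
  refine nonempty_isColimit_tensorCocone n k _ ?_ fun i hi J => ?_
  · exact IsColimit.mapCoconeEquiv
      (Functor.isoWhiskerRight (graftFunctorSelf h k f).symm (edgeFunctor C (decide (k ∈ I))))
      (nonempty_isColimit_blockCocone L (f ∘ innerIdx h k) (decide (k ∈ I))).some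
  · have := isIso_graftFunctor_map h k f hi ((blockCocone L (f ∘ innerIdx h k)).ι.app J)
    exact Functor.map_isIso (edgeFunctor C (decide (i ∈ I))) _

/-- The morphisms `z(I ∘_k J) ⟶ z(I)`, for `J ∈ L`, are jointly epic. -/
theorem rowLeg_hom_ext (I : Finset (Fin n)) {X : C}
    (u v : (cubical (polySeq h k f L)).obj I ⟶ X)
    (huv : ∀ J, rowLeg h k f L I J ≫ u = rowLeg h k f L I J ≫ v) : u = v := by
  refine (nonempty_isColimit_graftLeg h k f L I).some.hom_ext fun J => ?_
  have := congrArg ((substIso h k f I J.1).hom ≫ ·) (huv J)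
  simpa only [rowLeg, Category.assoc, Iso.hom_inv_id_assoc] using! this

/-- A compatible family of morphisms `z(I ∘_k J) ⟶ X`, for `J ∈ L`, factors through `z(I)`. -/
theorem exists_rowLeg_desc (I : Finset (Fin n)) {X : C}
    (u : ∀ J : L.FaceCat, (cubical f).obj (substFace h k I J.1) ⟶ X)
    (hu : ∀ {J J' : L.FaceCat} (hJ : J ≤ J'),
      (cubical f).map (homOfLE (substFace_mono h k (subset_refl I) hJ)) ≫ u J' = u J) :
    ∃ g : (cubical (polySeq h k f L)).obj I ⟶ X, ∀ J, rowLeg h k f L I J ≫ g = u J := by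
  let c : Cocone (tensorFunctor n fun i =>
      (L.incl ⋙ blockArrow (f ∘ innerIdx h k)) ⋙ graftFunctor h k f i ⋙
        edgeFunctor C (decide (i ∈ I))) :=
    { pt := X
      ι :=
        { app := fun J => (substIso h k f I J.1).hom ≫ u J
          naturality := fun J J' ψ => by
            have h₁ := blockSeqIso_naturality h k f (J := J.1) (J' := J'.1) (L.incl.map ψ)
              (a := fun i => decide (i ∈ I)) (a' := fun i => decide (i ∈ I))
              (decide_innerIdx_mem h k I J.1) (decide_outerIdx_mem h k I J.1)
              (decide_innerIdx_mem h k I J'.1) (decide_outerIdx_mem h k I J'.1)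
              (fun _ => le_refl _)
              (decide_mem_le (substFace_mono h k (subset_refl I) (leOfHom ψ)))
            refine Eq.trans ?_ (Category.comp_id _).symm
            refine Eq.trans ?_ (congrArg (_ ≫ ·) (hu (leOfHom ψ)))
            refine (Category.assoc _ _ _).symm.trans (Eq.trans ?_ (Category.assoc _ _ _))
            exact congrArg (· ≫ u J') h₁ } }
  refine ⟨(nonempty_isColimit_graftLeg h k f L I).some.desc c, fun J => ?_⟩
  exact (Category.assoc _ _ _).trans
    ((Iso.inv_comp_eq _).2 ((nonempty_isColimit_graftLeg h k f L I).some.fac c J))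

/-- Compatibility of the polyhedral product maps with substitution. -/
theorem exists_polyMap_subst_iso (K : SCpx n) :
    ∃ e : polyMap K (polySeq h k f L) ≅ polyMap (K.subst h k L) f,
      e.hom.left = (sourceIso h k K L f).hom := by
  have hl : ∀ S : (K.subst h k L).FaceCat, outerPart h k S.1 ∈ K.faces := by
    rintro ⟨_, I, hI, J, hJ, rfl⟩
    exact K.down_closed hI ((subset_substFace_iff h k _ I J).1 subset_rfl).1
  have hr : ∀ S : (K.subst h k L).FaceCat, innerPart h k S.1 ∈ L.faces := by
    rintro ⟨_, I, hI, J, hJ, rfl⟩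
    exact L.down_closed hJ ((subset_substFace_iff h k _ I J).1 subset_rfl).2
  have unit : ∀ S : Finset (Fin p), S ⊆ substFace h k (outerPart h k S) (innerPart h k S) :=
    fun S => (subset_substFace_iff h k S _ _).2 ⟨subset_rfl, subset_rfl⟩
  obtain ⟨t, ht⟩ := exists_colimit_iso_of_rows (A := K.FaceCat) (B := L.FaceCat)
    (K.incl ⋙ cubical (polySeq h k f L)) ((K.subst h k L).incl ⋙ cubical f)
    (fun I J => ⟨substFace h k I.1 J.1, I.1, I.2, J.1, J.2, rfl⟩)
    (fun {I I' J J'} hI hJ => substFace_mono h k hI hJ)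
    (fun S => ⟨outerPart h k S.1, hl S⟩) (fun S => ⟨innerPart h k S.1, hr S⟩)
    (fun S T hST => ((subset_substFace_iff h k _ _ _).1 (Finset.Subset.trans hST (unit T.1))).1)
    (fun S T hST => ((subset_substFace_iff h k _ _ _).1 (Finset.Subset.trans hST (unit T.1))).2)
    (fun S => unit S.1)
    (fun I J => ((subset_substFace_iff h k _ I.1 J.1).1 subset_rfl).1)
    (fun I J => ((subset_substFace_iff h k _ I.1 J.1).1 subset_rfl).2)
    (fun I J => rowLeg h k f L I.1 J)
    (fun {I I' J J'} hI hJ => rowLeg_naturality h k f L (K.incl.map (homOfLE hI)) (homOfLE hJ)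
      (homOfLE (substFace_mono h k hI hJ)))
    (fun I => rowLeg_hom_ext h k f L I.1)
    (fun I _ u hu => exists_rowLeg_desc h k f L I.1 u hu)
  exact ⟨(polyMapIsoMk (sourceIso h k K L f).symm t.symm
    ⟨substFace h k ∅ ∅, ∅, K.empty_mem, ∅, L.empty_mem, rfl⟩ ⟨∅, K.empty_mem⟩
    (rowLeg h k f L ∅ ⟨∅, L.empty_mem⟩) (cubicalFrom_rowLeg h k f L K ∅ ⟨∅, L.empty_mem⟩)
    ((Iso.comp_inv_eq _).2 ((ht ⟨∅, K.empty_mem⟩ ⟨∅, L.empty_mem⟩).symm.trans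
      (Category.assoc _ _ _).symm))).symm, rfl⟩

end Substitution

end PolyProd

theorem theorem3p14 {C : Type u} [Category.{v} C] [MonoidalCategory C] [SymmetricCategory C]
    [HasFiniteColimits C]
    [∀ X : C, PreservesFiniteColimits (tensorLeft X)]
    [∀ X : C, PreservesFiniteColimits (tensorRight X)] :
    (∀ (n : ℕ) (K : PolyProd.SCpx n) (σ : Equiv.Perm (Fin n)) (f : Fin n → Arrow C),
      ∃ e : PolyProd.polyMap (K.perm σ) (f ∘ σ) ≅ PolyProd.polyMap K f,
        e.hom.left = (PolyProd.permIso n σ (fun i => (f i).left)).hom) ∧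
    (∀ f : Fin 1 → Arrow C,
      ∃ e : PolyProd.polyMap PolyProd.SCpx.one f ≅ f 0, e.hom.left = (ρ_ (f 0).left).hom) ∧
    (∀ (n m p : ℕ) (h : p + 1 = n + m) (k : Fin n) (K : PolyProd.SCpx n) (L : PolyProd.SCpx m)
      (f : Fin p → Arrow C),
      ∃ e : PolyProd.polyMap K
            (PolyProd.graft h k (PolyProd.polyMap L (f ∘ PolyProd.innerIdx h k)) f) ≅
          PolyProd.polyMap (K.subst h k L) f,
        e.hom.left = (PolyProd.sourceIso h k K L f).hom) ∧
    ∃ alg : PolyProd.substOperad.Algebra (Quotient (isIsomorphicSetoid (Arrow C))),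
      ∀ (n : ℕ) (K : PolyProd.SCpx n) (f : Fin n → Arrow C),
        alg.act (n := n) K (fun i => Quotient.mk _ (f i)) =
          Quotient.mk _ (PolyProd.polyMap K f) :=
  ⟨fun _ K σ f => PolyProd.exists_polyMap_perm_iso K σ f, PolyProd.exists_polyMap_one_iso,
    fun _ _ _ h k K L f => PolyProd.exists_polyMap_subst_iso h k f L K,
    PolyProd.polyAlgebra fun h k K L f => ⟨(PolyProd.exists_polyMap_subst_iso h k f L K).choose⟩,
    fun _ K f => PolyProd.polyClass_mk K f⟩
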